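/- Let $\Omega$ be one of the compact connected two-point homogeneous spaces: the sphere $\mathbb S^d$ or a projective space $\mathbb{RP}^d,\mathbb{CP}^d,\mathbb{HP}^d$ with $d\ge 1$, or $\mathbb{OP}^1$ or $\mathbb{OP}^2$. Let $D$ be its dimension as a real manifold, that is, $d$ for $\mathbb S^d$ and $d\cdot\dim_{\mathbb R}\mathbb F$ for $\mathbb{FP}^d$. Let $\vartheta$ be the geodesic distance on $\Omega$ normalized so that $\operatorname{diam}\Omega=\pi$: on $\mathbb S^d$ it is $\vartheta(x,y)=\arccos(x\cdot y)$, and on $\mathbb{FP}^d$, whose points are the Hermitian $(d+1)\times(d+1)$ matrices $\Pi$ over $\mathbb F$ with $\Pi^2=\Pi$ and $\operatorname{Tr}\Pi=1$, it is given by $\cos\vartheta(\Pi_1,\Pi_2)=2\,\mathrm{Re}\,\mathrm{Tr}(\Pi_1\Pi_2)-1$. Let $\sigma$ be the uniform (isometry-invariant) Borel probability measure on $\Omega$, and let $B_\varepsilon(x)=\{z\in\Omega:\vartheta(z,x)<\varepsilon\}$, whose measure $\sigma(B_\varepsilon)$ does not depend on the center $x$. Let $0\le s<D$. There exist constants $A,C>0$,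 depending only on $\Omega$ and $s$, such that for all $\varepsilon>0$ and all $x,y\in\Omega$ the following holds. If $s>0$, then $$\frac{1}{(\sigma(B_\varepsilon))^2}\int_{B_\varepsilon(x)}\int_{B_\varepsilon(y)}\vartheta(u,v)^{-s}\,d\sigma(v)\,d\sigma(u)\ \le\ C\,\vartheta(x,y)^{-s},$$ where both sides take values in $[0,+\infty]$ and $0^{-s}=+\infty$. If $s=0$, then $\log\vartheta(u,v)$ is $\sigma\times\sigma$-integrable over $B_\varepsilon(x)\times B_\varepsilon(y)$ and $$\frac{1}{(\sigma(B_\varepsilon))^2}\int_{B_\varepsilon(x)}\int_{B_\varepsilon(y)}\bigl(-\log\vartheta(u,v)\bigr)\,d\sigma(v)\,d\sigma(u)\ \le\ A-C\log\vartheta(x,y),$$ where the right-hand side is $+\infty$ if $x=y$. -/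

import Mathlib

open MeasureTheory

noncomputable section

/-- The octonions `𝕆`, as pairs of quaternions (Cayley–Dickson doubling), with the Euclidean norm
and inner product of `ℍ × ℍ = ℝ⁸`. -/
def Octonion : Type := WithLp 2 (Quaternion ℝ × Quaternion ℝ)

namespace Octonion

instance : NormedAddCommGroup Octonion :=
  inferInstanceAs (NormedAddCommGroup (WithLp 2 (Quaternion ℝ × Quaternion ℝ)))

instance : InnerProductSpace ℝ Octonion :=
  inferInstanceAs (InnerProductSpace ℝ (WithLp 2 (Quaternion ℝ × Quaternion ℝ)))

/-- The octonion `a + b ℓ`. -/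
def mk (a b : Quaternion ℝ) : Octonion := WithLp.toLp 2 (a, b)

/-- The first quaternion component. -/
def left (x : Octonion) : Quaternion ℝ := (WithLp.ofLp x).1

/-- The second quaternion component. -/
def right (x : Octonion) : Quaternion ℝ := (WithLp.ofLp x).2

/-- Octonion multiplication `(a, b) (c, d) = (a c - d̄ b, d a + b c̄)`. -/
instance : Mul Octonion :=
  ⟨fun x y => mk (x.left * y.left - star y.right * x.right)
    (y.right * x.left + x.right * star y.left)⟩

instance : One Octonion := ⟨mk 1 0⟩

/-- Octonion conjugation `(a, b) ↦ (ā, -b)`. -/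
instance : Star Octonion := ⟨fun x => mk (star x.left) (-x.right)⟩

end Octonion

/-- The projective space `𝔽ℙᵈ`: Hermitian `(d+1) × (d+1)` projection matrices over `𝔽` of trace
one. For `𝔽 = ℝ, ℂ, ℍ` these are the orthogonal projections onto the lines of `𝔽^(d+1)`; for
`𝔽 = 𝕆` (and `d ≤ 2`) this is the standard definition. -/
def ProjSpace (F : Type) [NormedAddCommGroup F] [Mul F] [One F] [Star F] (d : ℕ) : Type :=
  {P : Matrix (Fin (d + 1)) (Fin (d + 1)) F // P.IsHermitian ∧ P * P = P ∧ P.trace = 1}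

namespace ProjSpace

variable {F : Type} [NormedAddCommGroup F] [Mul F] [One F] [Star F] {d : ℕ}

/-- The list of entries of a projection matrix, as a vector of the `ℓ²` product of copies
of `F`. -/
def entries (P : ProjSpace F d) : PiLp 2 (fun _ : Fin (d + 1) × Fin (d + 1) => F) :=
  WithLp.toLp 2 (fun p => P.1 p.1 p.2)

theorem entries_injective : Function.Injective (entries : ProjSpace F d → _) := by
  intro P Q h
  apply Subtype.ext
  ext i j
  exact congrFun (congrArg WithLp.ofLp h) (i, j)

/-- The Frobenius distance `‖P - Q‖`; it is `√2 sin (ϑ(P, Q) / 2)`, that is, `√2` times the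
chordal distance. -/
instance : MetricSpace (ProjSpace F d) :=
  MetricSpace.induced entries entries_injective inferInstance

/-- The geodesic distance of `𝔽ℙᵈ`, of diameter `π`: `cos ϑ(P, Q) = 2 Re Tr (P Q) - 1`, where
the real part of `a` in `𝔽` is its inner product with `1`. For `P`, `Q` the projections
onto the lines of unit vectors `p`, `q`, this is `cos ϑ = 2 |⟨p, q⟩|² - 1`. -/
def geodist [InnerProductSpace ℝ F] (P Q : ProjSpace F d) : ℝ :=
  Real.arccos (2 * inner ℝ (1 : F) (P.1 * Q.1).trace - 1)

end ProjSpace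

/-- The compact connected two-point homogeneous spaces: `𝕊ᵈ`, `ℝℙᵈ`, `ℂℙᵈ`, `ℍℙᵈ` for `d ≥ 1`,
and `𝕆ℙ¹`, `𝕆ℙ²`. -/
inductive TwoPointSpace : Type
  | sphere (d : ℕ) (hd : 1 ≤ d)
  | realProj (d : ℕ) (hd : 1 ≤ d)
  | complexProj (d : ℕ) (hd : 1 ≤ d)
  | quaternionProj (d : ℕ) (hd : 1 ≤ d)
  | octonionProj (d : ℕ) (hd : 1 ≤ d) (hd' : d ≤ 2)

namespace TwoPointSpace

/-- The dimension `D` of the space as a real manifold. -/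
def dim : TwoPointSpace → ℕ
  | sphere d _ => d
  | realProj d _ => d
  | complexProj d _ => 2 * d
  | quaternionProj d _ => 4 * d
  | octonionProj d _ _ => 8 * d

/-- The points of the space. -/
def Point : TwoPointSpace → Type
  | sphere d _ => Metric.sphere (0 : EuclideanSpace ℝ (Fin (d + 1))) 1
  | realProj d _ => ProjSpace ℝ d
  | complexProj d _ => ProjSpace ℂ d
  | quaternionProj d _ => ProjSpace (Quaternion ℝ) d
  | octonionProj d _ _ => ProjSpace Octonion d

/-- The geodesic distance `ϑ`, normalized so that the diameter is `π`. -/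
def geodist : (Ω : TwoPointSpace) → Ω.Point → Ω.Point → ℝ
  | sphere d _ => fun (x y : Metric.sphere (0 : EuclideanSpace ℝ (Fin (d + 1))) 1) =>
      Real.arccos (inner ℝ (x : EuclideanSpace ℝ (Fin (d + 1))) y)
  | realProj d _ => ProjSpace.geodist (F := ℝ) (d := d)
  | complexProj d _ => ProjSpace.geodist (F := ℂ) (d := d)
  | quaternionProj d _ => ProjSpace.geodist (F := Quaternion ℝ) (d := d)
  | octonionProj d _ _ => ProjSpace.geodist (F := Octonion) (d := d)

/-- The Euclidean distance on the sphere and the Frobenius distance on the projective spaces;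
both are constant multiples of `sin (ϑ / 2)`, hence induce the topology of `ϑ` and have the same
isometries. -/
instance : (Ω : TwoPointSpace) → MetricSpace Ω.Point
  | sphere d _ =>
      inferInstanceAs (MetricSpace (Metric.sphere (0 : EuclideanSpace ℝ (Fin (d + 1))) 1))
  | realProj d _ => inferInstanceAs (MetricSpace (ProjSpace ℝ d))
  | complexProj d _ => inferInstanceAs (MetricSpace (ProjSpace ℂ d))
  | quaternionProj d _ => inferInstanceAs (MetricSpace (ProjSpace (Quaternion ℝ) d))
  | octonionProj d _ _ => inferInstanceAs (MetricSpace (ProjSpace Octonion d))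

instance (Ω : TwoPointSpace) : MeasurableSpace Ω.Point := borel Ω.Point

instance (Ω : TwoPointSpace) : BorelSpace Ω.Point := ⟨rfl⟩

/-- The uniform probability measure `σ` on the space: the `D`-dimensional Hausdorff measure
(Riemannian volume up to a constant factor), normalized to total mass one. As `sin (ϑ / 2)`
is asymptotic to `ϑ / 2` at small distances, the Hausdorff measures of the chordal
and geodesic distances are proportional, so it does not matter which of the two is used. -/
def uniform (Ω : TwoPointSpace) : Measure Ω.Point :=
  (Measure.hausdorffMeasure (Ω.dim : ℝ) (Set.univ : Set Ω.Point))⁻¹ •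
    (Measure.hausdorffMeasure (Ω.dim : ℝ) : Measure Ω.Point)

/-- The open geodesic ball `B_ε(x)`. -/
def geoBall (Ω : TwoPointSpace) (ε : ℝ) (x : Ω.Point) : Set Ω.Point :=
  {z | Ω.geodist z x < ε}

end TwoPointSpace

end

/-! ### Riesz and logarithmic averages over an Ahlfors regular measure -/

section Energy

open Metric Filter Topology

/-! Only two facts about the space matter: `ϑ` lies between `dist` and `4 * dist`, where `dist` is
the chordal distance, and `σ` is Ahlfors regular of dimension `D`.

For `0 < s < D`, cap the radius as `r = min ε 4`. If `dist x y ≥ 4r`, then `ϑ u v` is at least `ϑ x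
y / 8` on the two balls, so the kernel itself is bounded by a multiple of its value at the centers.
If `dist x y < 4r`, the ball about `y` lies in `ball u (6r)` for each `u` near `x`. Upper regularity
and a dyadic sum bound the potential there by a multiple of `r ^ (D - s)`
(`exists_setLIntegral_dist_rpow_le`). Dividing by a mass of order at least `r ^ D` leaves `r ^
(-s)`, which is comparable to at most `ϑ x y ^ (-s)` because `ϑ x y ≤ 16 r`. The case `s = 0`
follows from the exponent `1/2` by Jensen's inequality for the logarithm.

Regularity comes from uniform bi-Lipschitz charts into a `D`-dimensional normed space, where
Hausdorff measure is a Haar measure (`HasUniformCharts.exists_hausdorffMeasure_ball_bounds`).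
Uniform chart constants replace any appeal to the isometry group. On the sphere the charts are
orthogonal projections to tangent hyperplanes (`hasUniformCharts_sphere`); on the projective spaces
they are the affine charts (`ProjSpace.hasUniformCharts`). The octonions are covered by the same
argument: a projection of trace one factors as column times row by a norm computation without
associativity (`ProjSpace.weight_smul_apply`). The single associative law needed, to build a
projection from affine coordinates, follows from alternativity when `d ≤ 2`, as one homogeneous
coordinate equals one. -/

theorem rpow_neg_le_tsum_indicator {X : Type*} [MetricSpace X] {s R : ℝ}
    (hs : 0 ≤ s) (hR : 0 < R) {u v : X}
    (hv : v ∈ ball u R) (huv : v ≠ u) :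
    ENNReal.ofReal (dist u v) ^ (-s) ≤
      ∑' n : ℕ, (ball u (2 * R * (1 / 2) ^ n)).indicator
        (fun _ => ENNReal.ofReal ((R * (1 / 2) ^ (n + 1)) ^ (-s))) v := by
  have hd : 0 < dist u v := dist_pos.2 huv.symm
  rw [mem_ball, dist_comm] at hv
  -- The dyadic shell `R / 2^(n+1) < dist u v ≤ R / 2^n`. The factor 2 in the radius of the
  -- indicator balls lets an open ball contain the closed end of the shell.
  obtain ⟨n, hn1, hn2⟩ := exists_nat_pow_near_of_lt_one (x := dist u v / R) (y := 1 / 2)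
    (by positivity) ((div_le_one hR).2 hv.le) (by norm_num) (by norm_num)
  rw [lt_div_iff₀ hR] at hn1
  rw [div_le_iff₀ hR] at hn2
  refine le_trans ?_ (ENNReal.le_tsum n)
  have hq : (0 : ℝ) < (1 / 2) ^ n := by positivity
  have hmem : v ∈ ball u (2 * R * (1 / 2) ^ n) := by
    rw [mem_ball, dist_comm]; nlinarith
  rw [Set.indicator_of_mem hmem, ENNReal.ofReal_rpow_of_pos hd]
  refine ENNReal.ofReal_le_ofReal (Real.rpow_le_rpow_of_nonpos (by positivity) ?_ (by linarith))
  linarith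

theorem ofReal_rpow_neg_anti {s a b : ℝ} (hs : 0 ≤ s) (h : a ≤ b) :
    ENNReal.ofReal b ^ (-s) ≤ ENNReal.ofReal a ^ (-s) := by
  rw [ENNReal.rpow_neg, ENNReal.rpow_neg]
  exact ENNReal.inv_le_inv.2 (ENNReal.rpow_le_rpow (ENNReal.ofReal_le_ofReal h) hs)

theorem measure_singleton_of_upper_regular {X : Type*} [MetricSpace X] [MeasurableSpace X]
    {σ : Measure X} {D : ℕ} (hD : 1 ≤ D) {c : ℝ}
    (hσ : ∀ (x : X) r, 0 < r → σ (ball x r) ≤ ENNReal.ofReal (c * r ^ D)) (u : X) :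
    σ {u} = 0 := by
  have h1 : Tendsto (fun r : ℝ => ENNReal.ofReal (c * r ^ D)) (𝓝[>] 0) (𝓝 0) := by
    have h2 : Continuous fun r : ℝ => ENNReal.ofReal (c * r ^ D) :=
      ENNReal.continuous_ofReal.comp (by fun_prop)
    have := h2.tendsto 0
    rw [zero_pow (by omega), mul_zero, ENNReal.ofReal_zero] at this
    exact this.mono_left nhdsWithin_le_nhds
  refine le_antisymm (ge_of_tendsto h1 ?_) zero_le
  filter_upwards [self_mem_nhdsWithin] with r hr
  exact (measure_mono (Set.singleton_subset_iff.2 (mem_ball_self hr))).trans (hσ u r hr)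

variable {X : Type*} [MetricSpace X] [MeasurableSpace X] [BorelSpace X] {σ : Measure X}

/-- `σ` is upper `D`-regular at all scales, and lower `D`-regular at scales at most one. -/
structure AhlforsRegular (σ : Measure X) (D : ℕ) : Prop where
  exists_upper : ∃ c : ℝ, 0 < c ∧ ∀ x r, 0 < r → σ (ball x r) ≤ ENNReal.ofReal (c * r ^ D)
  exists_lower : ∃ c : ℝ, 0 < c ∧ ∀ x r, 0 < r → r ≤ 1 →
    ENNReal.ofReal (c * r ^ D) ≤ σ (ball x r)

/-- The dyadic shell at scale `R / 2^n` contributes a multiple of `R ^ (D - s) * q ^ n`, and the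
ratio `q = 2 ^ (-(D - s))` is below one exactly because `s < D`. -/
theorem exists_setLIntegral_dist_rpow_le {D : ℕ} (hD : 1 ≤ D) {c : ℝ} (hc : 0 < c)
    (hσ : ∀ (x : X) r, 0 < r → σ (ball x r) ≤ ENNReal.ofReal (c * r ^ D))
    {s : ℝ} (hs : 0 ≤ s) (hsD : s < D) :
    ∃ K : ℝ, 0 < K ∧ ∀ u R, 0 < R →
      ∫⁻ v in ball u R, ENNReal.ofReal (dist u v) ^ (-s) ∂σ ≤
        ENNReal.ofReal (K * R ^ ((D : ℝ) - s)) := by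
  set q : ℝ := (1 / 2 : ℝ) ^ ((D : ℝ) - s) with hq
  have hq0 : 0 < q := by positivity
  have hq1 : q < 1 := Real.rpow_lt_one (by norm_num) (by norm_num) (by linarith)
  refine ⟨c * 2 ^ D * 2 ^ s * (1 - q)⁻¹, ?_, fun u R hR => ?_⟩
  · have : 0 < 1 - q := by linarith
    positivity
  have hne : ∀ᵐ v ∂σ, v ≠ u := by
    rw [ae_iff]; simpa using measure_singleton_of_upper_regular hD hσ u
  calc ∫⁻ v in ball u R, ENNReal.ofReal (dist u v) ^ (-s) ∂σ
      ≤ ∫⁻ v in ball u R, ∑' n : ℕ, (ball u (2 * R * (1 / 2) ^ n)).indicator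
        (fun _ => ENNReal.ofReal ((R * (1 / 2) ^ (n + 1)) ^ (-s))) v ∂σ := by
        refine lintegral_mono_ae ?_
        filter_upwards [ae_restrict_mem measurableSet_ball, ae_restrict_of_ae hne] with v hv huv
        exact rpow_neg_le_tsum_indicator hs hR hv huv
    _ ≤ ∫⁻ v, ∑' n : ℕ, (ball u (2 * R * (1 / 2) ^ n)).indicator
        (fun _ => ENNReal.ofReal ((R * (1 / 2) ^ (n + 1)) ^ (-s))) v ∂σ :=
        setLIntegral_le_lintegral _ _
    _ = ∑' n : ℕ, ENNReal.ofReal ((R * (1 / 2) ^ (n + 1)) ^ (-s)) *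
          σ (ball u (2 * R * (1 / 2) ^ n)) := by
        rw [lintegral_tsum fun n => (measurable_const.indicator measurableSet_ball).aemeasurable]
        simp_rw [lintegral_indicator_const measurableSet_ball]
    _ ≤ ∑' n : ℕ, ENNReal.ofReal (c * 2 ^ D * 2 ^ s * R ^ ((D : ℝ) - s) * q ^ n) := by
        refine ENNReal.tsum_le_tsum fun n => ?_
        refine (mul_le_mul_right (hσ u _ (by positivity)) _).trans (le_of_eq ?_)
        rw [← ENNReal.ofReal_mul (by positivity)]
        congr 1
        have e1 : (R * (1 / 2) ^ (n + 1)) ^ (-s) = R ^ (-s) * 2 ^ s * ((1 / 2 : ℝ) ^ (-s)) ^ n := by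
          rw [Real.mul_rpow hR.le (by positivity), ← Real.rpow_pow_comm (by norm_num), pow_succ]
          have : (1 / 2 : ℝ) ^ (-s) = 2 ^ s := by
            rw [one_div, Real.inv_rpow (by norm_num), Real.rpow_neg (by norm_num), inv_inv]
          rw [this]; ring
        have e2 : q = (1 / 2 : ℝ) ^ D * (1 / 2 : ℝ) ^ (-s) := by
          rw [hq, sub_eq_add_neg, Real.rpow_add (by norm_num), Real.rpow_natCast]
        have e3 : R ^ ((D : ℝ) - s) = R ^ D * R ^ (-s) := by
          rw [sub_eq_add_neg, Real.rpow_add hR, Real.rpow_natCast]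
        rw [e1, e2, e3, mul_pow, mul_pow, mul_pow]
        ring
    _ = ENNReal.ofReal (c * 2 ^ D * 2 ^ s * (1 - q)⁻¹ * R ^ ((D : ℝ) - s)) := by
        rw [← ENNReal.ofReal_tsum_of_nonneg (fun n => by positivity)
          ((summable_geometric_of_lt_one hq0.le hq1).mul_left _), tsum_mul_left,
          tsum_geometric_of_lt_one hq0.le hq1]
        congr 1; ring

variable {ϑ : X → X → ℝ}

/-- The averages of the Riesz kernel over two balls are controlled by its value at the centers. -/
theorem AhlforsRegular.exists_average_rpow_neg_le {D : ℕ} (hD : 1 ≤ D) (hσ : AhlforsRegular σ D)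
    (hϑ : ∀ x y, dist x y ≤ ϑ x y) (hϑ' : ∀ x y, ϑ x y ≤ 4 * dist x y)
    (hdiam : ∀ x y : X, dist x y ≤ 2) (hmeas : ∀ ε x, MeasurableSet {z | ϑ z x < ε})
    {s : ℝ} (hs : 0 < s) (hsD : s < D) :
    ∃ C : ℝ, 0 < C ∧ ∀ ε, 0 < ε → ∀ x y,
      (σ {z | ϑ z x < ε} * σ {z | ϑ z y < ε})⁻¹ *
          (∫⁻ u in {z | ϑ z x < ε}, ∫⁻ v in {z | ϑ z y < ε}, ENNReal.ofReal (ϑ u v) ^ (-s) ∂σ ∂σ)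
        ≤ ENNReal.ofReal C * ENNReal.ofReal (ϑ x y) ^ (-s) := by
  obtain ⟨c₂, hc₂, hup⟩ := hσ.exists_upper
  obtain ⟨c₁, hc₁, hlow⟩ := hσ.exists_lower
  obtain ⟨K, hK, hpot⟩ := exists_setLIntegral_dist_rpow_le hD hc₂ hup hs.le hsD
  set C : ℝ := 8 ^ s + K * 6 ^ ((D : ℝ) - s) / (c₁ * (1 / 4) ^ D) * 16 ^ s with hC
  have hC0 : 0 < C := by positivity
  refine ⟨C, hC0, fun ε hε x y => ?_⟩
  -- On the diagonal the right-hand side is infinite.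
  rcases eq_or_ne x y with rfl | hxy
  · have : ϑ x x = 0 := le_antisymm (by simpa using hϑ' x x) (by simpa using hϑ x x)
    rw [this, ENNReal.ofReal_zero, ENNReal.zero_rpow_of_neg (by linarith), ENNReal.mul_top]
    · exact le_top
    · simpa using hC0
  have hdxy : 0 < dist x y := dist_pos.2 hxy
  -- Since `dist ≤ 2`, balls of radius beyond 4 are the whole space. The cap gives `r / 4 ≤ 1`, the
  -- range in which lower regularity is available.
  set r := min ε 4 with hr
  have hr0 : 0 < r := by positivity
  have hsub : ∀ x, {z | ϑ z x < ε} ⊆ ball x r := fun x z hz =>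
    lt_min ((hϑ z x).trans_lt hz) ((hdiam z x).trans_lt (by norm_num))
  have hsup : ∀ x, ball x (r / 4) ⊆ {z | ϑ z x < ε} := fun x z hz => by
    have h1 := hϑ' z x
    have h2 : dist z x < r / 4 := hz
    have h3 : r ≤ ε := min_le_left _ _
    show ϑ z x < ε
    linarith
  have hlb : ∀ x, ENNReal.ofReal (c₁ * (r / 4) ^ D) ≤ σ {z | ϑ z x < ε} := fun x =>
    (hlow x (r / 4) (by positivity) (by linarith [min_le_right ε 4])).trans
      (measure_mono (hsup x))
  have hpos : ∀ x, σ {z | ϑ z x < ε} ≠ 0 := fun x =>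
    (lt_of_lt_of_le (ENNReal.ofReal_pos.2 (by positivity)) (hlb x)).ne'
  have hfin : ∀ x, σ {z | ϑ z x < ε} ≠ ⊤ := fun x =>
    (((measure_mono (hsub x)).trans (hup x r hr0)).trans_lt ENNReal.ofReal_lt_top).ne
  have hϑxy : 0 < ϑ x y := hdxy.trans_le (hϑ x y)
  rcases le_or_gt (4 * r) (dist x y) with hfar | hnear
  · have key : ∀ u ∈ {z | ϑ z x < ε}, ∀ v ∈ {z | ϑ z y < ε},
        ENNReal.ofReal (ϑ u v) ^ (-s) ≤ ENNReal.ofReal (8 ^ s * (ϑ x y) ^ (-s)) := by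
      intro u hu v hv
      have h1 : dist u x < r := hsub x hu
      have h2 : dist v y < r := hsub y hv
      have h3 : dist x y ≤ dist u x + dist u v + dist v y := by
        have h4 := dist_triangle x u y
        have h5 := dist_triangle u v y
        rw [dist_comm x u] at h4
        linarith
      -- Here `dist u v ≥ dist x y - 2r ≥ dist x y / 2`, and comparing `ϑ` with `dist` costs another
      -- factor 4.
      have h6 : ϑ x y / 8 ≤ ϑ u v := by linarith [hϑ' x y, hϑ u v]
      refine (ofReal_rpow_neg_anti hs.le h6).trans (le_of_eq ?_)
      rw [ENNReal.ofReal_rpow_of_pos (by positivity), Real.div_rpow hϑxy.le (by norm_num),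
        Real.rpow_neg (by norm_num : (0 : ℝ) ≤ 8)]
      congr 1
      field_simp
    calc _ ≤ (σ {z | ϑ z x < ε} * σ {z | ϑ z y < ε})⁻¹ *
          (ENNReal.ofReal (8 ^ s * (ϑ x y) ^ (-s)) * σ {z | ϑ z y < ε} * σ {z | ϑ z x < ε}) := by
          gcongr
          rw [← setLIntegral_const]
          refine setLIntegral_mono' (hmeas ε x) fun u hu => ?_
          rw [← setLIntegral_const]
          exact setLIntegral_mono' (hmeas ε y) fun v hv => key u hu v hv
      _ = ENNReal.ofReal (8 ^ s * (ϑ x y) ^ (-s)) := by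
          rw [mul_assoc, mul_comm (σ {z | ϑ z y < ε}), mul_left_comm, ENNReal.inv_mul_cancel
            (mul_ne_zero (hpos x) (hpos y)) (ENNReal.mul_ne_top (hfin x) (hfin y)), mul_one]
      _ ≤ ENNReal.ofReal (C * (ϑ x y) ^ (-s)) := by
          refine ENNReal.ofReal_le_ofReal (mul_le_mul_of_nonneg_right ?_ (by positivity))
          rw [hC]; exact le_add_of_nonneg_right (by positivity)
      _ = _ := by rw [ENNReal.ofReal_rpow_of_pos hϑxy, ENNReal.ofReal_mul hC0.le]
  -- The radius `6r` is `r + 4r + r`, along the path from `v` through `y` and `x` to `u`.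
  · have key : ∀ u ∈ {z | ϑ z x < ε},
        ∫⁻ v in {z | ϑ z y < ε}, ENNReal.ofReal (ϑ u v) ^ (-s) ∂σ ≤
          ENNReal.ofReal (K * (6 * r) ^ ((D : ℝ) - s)) := by
      intro u hu
      have h1 : dist u x < r := hsub x hu
      refine le_trans ?_ (hpot u (6 * r) (by positivity))
      refine (lintegral_mono fun v => ofReal_rpow_neg_anti hs.le (hϑ u v)).trans
        (lintegral_mono_set fun v hv => ?_)
      have h2 : dist v y < r := hsub y hv
      have h4 := dist_triangle v y u
      have h5 := dist_triangle y x u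
      rw [dist_comm y x, dist_comm x u] at h5
      rw [mem_ball]
      linarith
    calc _ ≤ (σ {z | ϑ z x < ε} * σ {z | ϑ z y < ε})⁻¹ *
          (ENNReal.ofReal (K * (6 * r) ^ ((D : ℝ) - s)) * σ {z | ϑ z x < ε}) := by
          gcongr
          rw [← setLIntegral_const]
          exact setLIntegral_mono' (hmeas ε x) key
      _ = ENNReal.ofReal (K * (6 * r) ^ ((D : ℝ) - s)) * (σ {z | ϑ z y < ε})⁻¹ := by
          rw [ENNReal.mul_inv (Or.inl (hpos x)) (Or.inl (hfin x)), mul_left_comm,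
            mul_right_comm, ENNReal.inv_mul_cancel (hpos x) (hfin x), one_mul]
      _ ≤ ENNReal.ofReal (K * (6 * r) ^ ((D : ℝ) - s)) *
            (ENNReal.ofReal (c₁ * (r / 4) ^ D))⁻¹ := by
          gcongr
          exact hlb y
      _ = ENNReal.ofReal (K * (6 * r) ^ ((D : ℝ) - s) * (c₁ * (r / 4) ^ D)⁻¹) := by
          rw [← ENNReal.ofReal_inv_of_pos (by positivity), ← ENNReal.ofReal_mul (by positivity)]
      -- The power of `r` left over is `r ^ (-s)`, rewritten with `16 r` because `ϑ x y ≤ 4 * dist x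
      -- y < 16 r`.
      _ = ENNReal.ofReal (K * 6 ^ ((D : ℝ) - s) / (c₁ * (1 / 4) ^ D) * 16 ^ s *
            (16 * r) ^ (-s)) := by
          congr 1
          rw [Real.mul_rpow (by norm_num) hr0.le, Real.mul_rpow (by norm_num) hr0.le,
            sub_eq_add_neg, Real.rpow_add hr0, Real.rpow_natCast, Real.rpow_neg (x := 16)
            (by norm_num), div_eq_mul_one_div r, mul_pow]
          field_simp
      _ ≤ ENNReal.ofReal (C * (ϑ x y) ^ (-s)) := by
          refine ENNReal.ofReal_le_ofReal (mul_le_mul ?_ ?_ (by positivity) hC0.le)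
          · rw [hC]; exact le_add_of_nonneg_left (by positivity)
          · exact Real.rpow_le_rpow_of_nonpos hϑxy (by linarith [hϑ' x y]) (by linarith)
      _ = _ := by rw [ENNReal.ofReal_rpow_of_pos hϑxy, ENNReal.ofReal_mul hC0.le]

theorem abs_log_le_two_mul_rpow_add {t : ℝ} (ht0 : 0 ≤ t) (ht : t ≤ 8) :
    |Real.log t| ≤ 2 * t ^ (-(1 / 2) : ℝ) + 8 := by
  -- At zero both `Real.log 0` and the real power `0 ^ (-1/2)` take the default value 0.
  rcases ht0.eq_or_lt with rfl | hpos
  · simp [Real.zero_rpow]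
  have h0 : 0 < t ^ (-(1 / 2) : ℝ) := by positivity
  have h1 := Real.log_le_sub_one_of_pos h0
  rw [Real.log_rpow hpos] at h1
  have h2 := Real.log_le_sub_one_of_pos hpos
  rw [abs_le]
  constructor <;> linarith

theorem AhlforsRegular.integrable_rpow_neg_half [SecondCountableTopology X] [IsFiniteMeasure σ]
    {D : ℕ} (hD : 1 ≤ D) (hσ : AhlforsRegular σ D)
    (hϑ : ∀ x y, dist x y ≤ ϑ x y)
    (hdiam : ∀ x y : X, dist x y ≤ 2) (hcont : Continuous fun p : X × X => ϑ p.1 p.2) :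
    Integrable (fun p : X × X => ϑ p.1 p.2 ^ (-(1 / 2) : ℝ)) (σ.prod σ) := by
  obtain ⟨c₂, hc₂, hup⟩ := hσ.exists_upper
  have hD' : (1 / 2 : ℝ) < D := by
    have : (1 : ℝ) ≤ D := by exact_mod_cast hD
    linarith
  obtain ⟨K, hK, hpot⟩ := exists_setLIntegral_dist_rpow_le hD hc₂ hup
    (by norm_num : (0 : ℝ) ≤ 1 / 2) hD'
  have hm : Measurable (fun p : X × X => ϑ p.1 p.2 ^ (-(1 / 2) : ℝ)) :=
    hcont.measurable.pow_const _
  have h0 : ∀ x y, 0 ≤ ϑ x y := fun x y => dist_nonneg.trans (hϑ x y)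
  refine ⟨hm.aestronglyMeasurable, ?_⟩
  rw [hasFiniteIntegral_iff_ofReal (ae_of_all _ fun p => Real.rpow_nonneg (h0 _ _) _),
    lintegral_prod _ hm.ennreal_ofReal.aemeasurable]
  refine lt_of_le_of_lt (b := ∫⁻ _, ENNReal.ofReal (K * 4 ^ ((D : ℝ) - 1 / 2)) ∂σ) ?_ ?_
  · refine lintegral_mono fun u => le_trans ?_ (hpot u 4 (by norm_num))
    rw [show ball u 4 = Set.univ from Set.eq_univ_of_forall fun v =>
      (hdiam v u).trans_lt (by norm_num), Measure.restrict_univ]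
    refine lintegral_mono fun v => le_trans ?_ (ofReal_rpow_neg_anti (by norm_num) (hϑ u v))
    rcases (h0 u v).eq_or_lt with h | h
    · simp [← h, Real.zero_rpow]
    · simp [ENNReal.ofReal_rpow_of_pos h]
  · rw [lintegral_const]
    exact ENNReal.mul_lt_top ENNReal.ofReal_lt_top (measure_lt_top _ _)

/-- Write `-log ϑ = 2 log (ϑ ^ (-1/2))` and use concavity of the logarithm: the average is at most
twice the logarithm of the average of `ϑ ^ (-1/2)`. The exponent `1/2` is below every dimension `D ≥
1`. -/
theorem AhlforsRegular.exists_average_log_le [SecondCountableTopology X] [IsFiniteMeasure σ]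
    {D : ℕ} (hD : 1 ≤ D) (hσ : AhlforsRegular σ D)
    (hϑ : ∀ x y, dist x y ≤ ϑ x y) (hϑ' : ∀ x y, ϑ x y ≤ 4 * dist x y)
    (hdiam : ∀ x y : X, dist x y ≤ 2) (hcont : Continuous fun p : X × X => ϑ p.1 p.2) :
    ∃ A : ℝ, 0 < A ∧ ∀ ε, 0 < ε → ∀ x y,
      IntegrableOn (fun p : X × X => -Real.log (ϑ p.1 p.2))
        ({z | ϑ z x < ε} ×ˢ {z | ϑ z y < ε}) (σ.prod σ) ∧
      (x ≠ y → (σ.real {z | ϑ z x < ε} * σ.real {z | ϑ z y < ε})⁻¹ *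
          (∫ u in {z | ϑ z x < ε}, ∫ v in {z | ϑ z y < ε}, -Real.log (ϑ u v) ∂σ ∂σ)
        ≤ A - Real.log (ϑ x y)) := by
  have hmeas : ∀ ε x, MeasurableSet {z | ϑ z x < ε} := fun ε x =>
    (isOpen_lt (hcont.comp (continuous_id.prodMk continuous_const)) continuous_const).measurableSet
  have hD' : (1 / 2 : ℝ) < D := by
    have : (1 : ℝ) ≤ D := by exact_mod_cast hD
    linarith
  obtain ⟨C, hC, hmain⟩ := hσ.exists_average_rpow_neg_le hD hϑ hϑ' hdiam hmeas
    (by norm_num : (0 : ℝ) < 1 / 2) hD'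
  obtain ⟨c₁, hc₁, hlow⟩ := hσ.exists_lower
  obtain ⟨c₂, hc₂, hup⟩ := hσ.exists_upper
  have hint := hσ.integrable_rpow_neg_half hD hϑ hdiam hcont
  have h0 : ∀ x y, 0 ≤ ϑ x y := fun x y => dist_nonneg.trans (hϑ x y)
  have hlog : Integrable (fun p : X × X => -Real.log (ϑ p.1 p.2)) (σ.prod σ) := by
    refine ((hint.const_mul 2).add (integrable_const 8)).mono'
      (Real.measurable_log.comp hcont.measurable).neg.aestronglyMeasurable
      (ae_of_all _ fun p => ?_)
    rw [norm_neg, Real.norm_eq_abs]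
    exact abs_log_le_two_mul_rpow_add (h0 _ _) (by linarith [hϑ' p.1 p.2, hdiam p.1 p.2])
  have hdiag : ∀ᵐ p ∂(σ.prod σ), 0 < ϑ p.1 p.2 := by
    have hms : MeasurableSet {p : X × X | 0 < ϑ p.1 p.2} :=
      (isOpen_lt continuous_const hcont).measurableSet
    rw [Measure.ae_prod_iff_ae_ae hms]
    refine ae_of_all _ fun u => ?_
    have hne : ∀ᵐ v ∂σ, v ≠ u := by
      rw [ae_iff]; simpa using measure_singleton_of_upper_regular hD hup u
    filter_upwards [hne] with v hv
    exact (dist_pos.2 hv.symm).trans_le (hϑ u v)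
  -- The maximum with 1 only makes the additive constant positive.
  refine ⟨max 1 (2 * Real.log C), by positivity, fun ε hε x y => ⟨hlog.integrableOn, ?_⟩⟩
  intro hxy
  have hϑxy : 0 < ϑ x y := (dist_pos.2 hxy).trans_le (hϑ x y)
  set B := {z | ϑ z x < ε} with hB
  set B' := {z | ϑ z y < ε} with hB'
  have hpos : ∀ x, 0 < σ.real {z | ϑ z x < ε} := fun x => by
    refine ENNReal.toReal_pos ?_ (measure_ne_top _ _)
    have hr : 0 < min (ε / 4) 1 := by positivity
    refine (lt_of_lt_of_le (ENNReal.ofReal_pos.2 (by positivity))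
      ((hlow x _ hr (min_le_right _ _)).trans (measure_mono fun z hz => ?_))).ne'
    have h1 := hϑ' z x
    have h2 : dist z x < ε / 4 := lt_of_lt_of_le hz (min_le_left _ _)
    show ϑ z x < ε
    linarith
  set M := C * ϑ x y ^ (-(1 / 2) : ℝ) with hM
  have hM0 : 0 < M := by positivity
  have hI : ∫ p in B ×ˢ B', ϑ p.1 p.2 ^ (-(1 / 2) : ℝ) ∂(σ.prod σ) ≤ M * (σ.real B * σ.real B') := by
    have hm : Measurable (fun p : X × X => ϑ p.1 p.2 ^ (-(1 / 2) : ℝ)) :=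
      hcont.measurable.pow_const _
    rw [integral_eq_lintegral_of_nonneg_ae (ae_of_all _ fun p => Real.rpow_nonneg (h0 _ _) _)
      hm.aestronglyMeasurable]
    refine ENNReal.toReal_le_of_le_ofReal
      (mul_nonneg hM0.le (mul_nonneg measureReal_nonneg measureReal_nonneg)) ?_
    have h1 := hmain ε hε x y
    rw [← hB, ← hB', mul_comm, ← div_eq_mul_inv, ENNReal.div_le_iff_le_mul (Or.inl (mul_ne_zero
      ((ENNReal.toReal_pos_iff.1 (hpos x)).1.ne') ((ENNReal.toReal_pos_iff.1 (hpos y)).1.ne')))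
      (Or.inl (ENNReal.mul_ne_top (measure_ne_top _ _) (measure_ne_top _ _)))] at h1
    rw [ENNReal.ofReal_mul hM0.le, hM, ENNReal.ofReal_mul hC.le, measureReal_def, measureReal_def,
      ← ENNReal.toReal_mul, ENNReal.ofReal_toReal
        (ENNReal.mul_ne_top (measure_ne_top _ _) (measure_ne_top _ _)),
      ← ENNReal.ofReal_rpow_of_pos hϑxy]
    refine le_trans ?_ h1
    rw [← Measure.prod_restrict, lintegral_prod _ hm.ennreal_ofReal.aemeasurable]
    refine lintegral_mono fun u => lintegral_mono fun v => ?_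
    rcases (h0 u v).eq_or_lt with h | h
    · simp [← h, Real.zero_rpow]
    · simp [ENNReal.ofReal_rpow_of_pos h]
  -- Jensen's inequality as a tangent line: `log (t / M) ≤ t / M - 1` with `t = ϑ ^ (-1/2)` and `M`
  -- an upper bound for the average of `t`. After averaging, the terms `2` and `-2` cancel.
  have hI2 : ∫ p in B ×ˢ B', -Real.log (ϑ p.1 p.2) ∂(σ.prod σ) ≤
      ∫ p in B ×ˢ B', (2 / M * ϑ p.1 p.2 ^ (-(1 / 2) : ℝ) + 2 * (Real.log M - 1)) ∂(σ.prod σ) := by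
    refine integral_mono_ae hlog.integrableOn
      ((hint.const_mul _).add (integrable_const _)).integrableOn (ae_restrict_of_ae ?_)
    filter_upwards [hdiag] with p hp
    have h1 : 0 < ϑ p.1 p.2 ^ (-(1 / 2) : ℝ) := by positivity
    have h2 := Real.log_le_sub_one_of_pos (div_pos h1 hM0)
    rw [Real.log_div h1.ne' hM0.ne', Real.log_rpow hp] at h2
    have h3 : 2 / M * ϑ p.1 p.2 ^ (-(1 / 2) : ℝ) = 2 * (ϑ p.1 p.2 ^ (-(1 / 2) : ℝ) / M) := by ring
    simp only [h3]
    linarith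
  have hprod : (σ.prod σ).real (B ×ˢ B') = σ.real B * σ.real B' := by
    rw [measureReal_def, Measure.prod_prod, ENNReal.toReal_mul]; rfl
  rw [integral_add (hint.const_mul _).integrableOn (integrable_const _), integral_const_mul,
    setIntegral_const, hprod, smul_eq_mul] at hI2
  rw [← setIntegral_prod (fun p : X × X => -Real.log (ϑ p.1 p.2)) hlog.integrableOn]
  have hab : 0 < σ.real B * σ.real B' := mul_pos (hpos x) (hpos y)
  rw [inv_mul_le_iff₀ hab]
  have h4 : 2 / M * ∫ p in B ×ˢ B', ϑ p.1 p.2 ^ (-(1 / 2) : ℝ) ∂(σ.prod σ) ≤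
      2 * (σ.real B * σ.real B') := by
    calc _ ≤ 2 / M * (M * (σ.real B * σ.real B')) :=
          mul_le_mul_of_nonneg_left hI (by positivity)
      _ = _ := by field_simp
  have h5 : 2 * Real.log M = 2 * Real.log C - Real.log (ϑ x y) := by
    rw [hM, Real.log_mul hC.ne' (by positivity), Real.log_rpow hϑxy]; ring
  have h6 : 2 * Real.log M ≤ max 1 (2 * Real.log C) - Real.log (ϑ x y) := by
    linarith [le_max_right 1 (2 * Real.log C)]
  calc _ ≤ σ.real B * σ.real B' * (2 * Real.log M) := by linarith
    _ ≤ _ := mul_le_mul_of_nonneg_left h6 hab.le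

end Energy

/-! ### Ahlfors regularity from uniform bi-Lipschitz charts -/

section Charts

open Metric Filter Topology NNReal

variable {X : Type*} [MetricSpace X] [MeasurableSpace X] [BorelSpace X]
  {E : Type*} [NormedAddCommGroup E] [NormedSpace ℝ E] [FiniteDimensional ℝ E]

/-- Around each point there is a chart with values in `E`, bi-Lipschitz with uniform constants,
whose domain and range contain balls of uniform size. -/
structure HasUniformCharts (X E : Type*) [MetricSpace X] [NormedAddCommGroup E] : Prop where
  out : ∃ (r₀ r₁ : ℝ) (K L : ℝ≥0), 0 < r₀ ∧ 0 < r₁ ∧ ∀ x : X, ∃ (S : Set X) (ψ : X → E),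
    ball x r₀ ⊆ S ∧ (∀ y ∈ S, ∀ z ∈ S, dist (ψ y) (ψ z) ≤ K * dist y z) ∧
    (∀ y ∈ S, ∀ z ∈ S, dist y z ≤ L * dist (ψ y) (ψ z)) ∧ ball (ψ x) r₁ ⊆ ψ '' S

/-- A `K`-Lipschitz map multiplies `D`-dimensional Hausdorff measure by at most `K ^ D`. Apply this
to the chart, whose image of `ball x r` contains a ball of radius `r / L`, and to its inverse, as
that image lies in a ball of radius `K * r`. -/
theorem HasUniformCharts.exists_hausdorffMeasure_ball_bounds [Nontrivial E]
    (h : HasUniformCharts X E) {D : ℕ} (hD : Module.finrank ℝ E = D) :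
    ∃ c₁ c₂ ρ : ℝ, 0 < c₁ ∧ 0 < c₂ ∧ 0 < ρ ∧ ∀ (x : X) r, 0 < r → r ≤ ρ →
      ENNReal.ofReal (c₁ * r ^ D) ≤ μH[D] (ball x r) ∧
      μH[D] (ball x r) ≤ ENNReal.ofReal (c₂ * r ^ D) := by
  obtain ⟨r₀, r₁, K', L', hr₀, hr₁, hch'⟩ := h.out
  obtain ⟨K, L, hK, hL, hch⟩ : ∃ K L : ℝ≥0, 0 < K ∧ 0 < L ∧ ∀ x : X, ∃ (S : Set X) (ψ : X → E),
      ball x r₀ ⊆ S ∧ (∀ y ∈ S, ∀ z ∈ S, dist (ψ y) (ψ z) ≤ K * dist y z) ∧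
      (∀ y ∈ S, ∀ z ∈ S, dist y z ≤ L * dist (ψ y) (ψ z)) ∧ ball (ψ x) r₁ ⊆ ψ '' S := by
    -- Enlarging the constants makes them positive, so that they can be inverted.
    refine ⟨K' + 1, L' + 1, by positivity, by positivity, fun x => ?_⟩
    obtain ⟨S, ψ, h1, h2, h3, h4⟩ := hch' x
    refine ⟨S, ψ, h1, fun y hy z hz => (h2 y hy z hz).trans ?_,
      fun y hy z hz => (h3 y hy z hz).trans ?_, h4⟩
    · push_cast; nlinarith [dist_nonneg (x := y) (y := z)]
    · push_cast; nlinarith [dist_nonneg (x := ψ y) (y := ψ z)]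
  let : MeasurableSpace E := borel E
  have : BorelSpace E := ⟨rfl⟩
  have hHaar : (μH[D] : Measure E).IsAddHaarMeasure := by
    rw [← hD]; exact isAddHaarMeasure_hausdorffMeasure
  set m : ℝ := (μH[D] : Measure E).real (ball 0 1) with hm
  have hm0 : 0 < m := ENNReal.toReal_pos (measure_ball_pos _ _ one_pos).ne' measure_ball_lt_top.ne
  have hball : ∀ (w : E) r, 0 < r → μH[D] (ball w r) = ENNReal.ofReal (m * r ^ D) := by
    intro w r hr
    rw [Measure.addHaar_ball _ _ hr.le, hD, mul_comm, ENNReal.ofReal_mul hm0.le, hm,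
      measureReal_def, ENNReal.ofReal_toReal measure_ball_lt_top.ne]
  have hKpow : ∀ M : ℝ≥0, (M : ENNReal) ^ (D : ℝ) = ENNReal.ofReal ((M : ℝ) ^ D) := by
    intro M
    rw [ENNReal.rpow_natCast, ENNReal.ofReal_pow M.coe_nonneg, ENNReal.ofReal_coe_nnreal]
  refine ⟨((K : ℝ) ^ D)⁻¹ * (m * ((L : ℝ)⁻¹) ^ D), (L : ℝ) ^ D * (m * (K : ℝ) ^ D),
    min r₀ (L * r₁), by positivity, by positivity, by positivity, fun x r hr hrρ => ?_⟩
  obtain ⟨S, ψ, hS, hψ, hψ', hr1⟩ := hch x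
  have hrr0 : r ≤ r₀ := hrρ.trans (min_le_left _ _)
  have hrS : ball x r ⊆ S := (ball_subset_ball hrr0).trans hS
  have hxS : x ∈ S := hS (mem_ball_self hr₀)
  have hLip : LipschitzOnWith K ψ (ball x r) := LipschitzOnWith.of_dist_le_mul
    fun y hy z hz => hψ y (hrS hy) z (hrS hz)
  constructor
  · set ρ := (L : ℝ)⁻¹ * r with hρ
    have hρ0 : 0 < ρ := by positivity
    have hsub : ball (ψ x) ρ ⊆ ψ '' ball x r := by
      intro w hw
      have hρr : ρ ≤ r₁ := by
        rw [hρ, inv_mul_le_iff₀ (by positivity)]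
        exact hrρ.trans (min_le_right _ _)
      obtain ⟨z, hz, rfl⟩ := hr1 (ball_subset_ball hρr hw)
      refine ⟨z, ?_, rfl⟩
      rw [mem_ball] at hw ⊢
      calc dist z x ≤ L * dist (ψ z) (ψ x) := hψ' z hz x hxS
        _ < L * ρ := by gcongr
        _ = r := by rw [hρ]; field_simp
    have h1 := (measure_mono hsub).trans (hLip.hausdorffMeasure_image_le (Nat.cast_nonneg D))
    rw [hball _ _ hρ0, hKpow] at h1
    rw [mul_assoc, ENNReal.ofReal_mul (by positivity), ENNReal.ofReal_inv_of_pos (by positivity),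
      mul_comm, ← div_eq_mul_inv, ENNReal.div_le_iff_le_mul
      (Or.inl (ENNReal.ofReal_pos.2 (by positivity)).ne')
      (Or.inl ENNReal.ofReal_ne_top), mul_comm (μH[D] _)]
    refine le_trans (le_of_eq ?_) h1
    rw [hρ, mul_pow, mul_assoc]
  · have hinj : Set.InjOn ψ (ball x r) := by
      intro y hy z hz hyz
      have := hψ' y (hrS hy) z (hrS hz)
      rw [hyz, dist_self, mul_zero] at this
      exact dist_le_zero.1 this
    have : Nonempty X := ⟨x⟩
    set φ := Function.invFunOn ψ (ball x r) with hφ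
    have hinv : ∀ y ∈ ball x r, φ (ψ y) = y := fun y hy => hinj.leftInvOn_invFunOn hy
    have hφL : LipschitzOnWith L φ (ψ '' ball x r) := by
      refine LipschitzOnWith.of_dist_le_mul ?_
      rintro _ ⟨y, hy, rfl⟩ _ ⟨z, hz, rfl⟩
      rw [hinv y hy, hinv z hz]
      exact hψ' y (hrS hy) z (hrS hz)
    have himg : φ '' (ψ '' ball x r) = ball x r := by
      rw [Set.image_image]
      exact (Set.image_congr hinv).trans (Set.image_id' _)
    have hsub : ψ '' ball x r ⊆ ball (ψ x) (K * r) := by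
      rintro _ ⟨y, hy, rfl⟩
      rw [mem_ball] at hy ⊢
      exact (hψ y (hrS hy) x hxS).trans_lt (by gcongr)
    have h1 := hφL.hausdorffMeasure_image_le (Nat.cast_nonneg D)
    rw [himg] at h1
    refine h1.trans ?_
    rw [hKpow]
    refine (mul_le_mul_right (measure_mono hsub) _).trans (le_of_eq ?_)
    rw [hball _ _ (by positivity), ← ENNReal.ofReal_mul (by positivity), mul_pow]
    congr 1; ring

/-- Finitely many balls of radius `ρ` cover the space, so the total mass is finite. Above the scale
`ρ` the upper bound follows from total mass one. The lower bound up to scale 1 uses the smaller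
radius `min ρ 1 * r`. -/
theorem HasUniformCharts.normalized_hausdorffMeasure [Nonempty X] [Nontrivial E]
    (h : HasUniformCharts X E) {D : ℕ} (hD : Module.finrank ℝ E = D)
    (htb : TotallyBounded (Set.univ : Set X)) :
    IsFiniteMeasure ((μH[D] (Set.univ : Set X))⁻¹ • (μH[D] : Measure X)) ∧
      AhlforsRegular ((μH[D] (Set.univ : Set X))⁻¹ • (μH[D] : Measure X)) D := by
  obtain ⟨c₁, c₂, ρ, hc₁, hc₂, hρ, hb⟩ := h.exists_hausdorffMeasure_ball_bounds hD
  have hfin : μH[D] (Set.univ : Set X) ≠ ⊤ := by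
    obtain ⟨t, ht, hcov⟩ := totallyBounded_iff.1 htb ρ hρ
    refine ((measure_mono hcov).trans_lt ?_).ne
    refine (measure_biUnion_lt_top ht fun x _ => ?_)
    exact (hb x ρ hρ le_rfl).2.trans_lt ENNReal.ofReal_lt_top
  have hpos : μH[D] (Set.univ : Set X) ≠ 0 := by
    obtain ⟨x⟩ := ‹Nonempty X›
    refine ((lt_of_lt_of_le (ENNReal.ofReal_pos.2 ?_) ((hb x ρ hρ le_rfl).1.trans
      (measure_mono (Set.subset_univ _))))).ne'
    positivity
  set T : ℝ := (μH[D] (Set.univ : Set X)).toReal with hT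
  have hT0 : 0 < T := ENNReal.toReal_pos hpos hfin
  have hTe : μH[D] (Set.univ : Set X) = ENNReal.ofReal T := (ENNReal.ofReal_toReal hfin).symm
  have hsm : ∀ s : Set X, ((μH[D] (Set.univ : Set X))⁻¹ • (μH[D] : Measure X)) s =
      ENNReal.ofReal T⁻¹ * μH[D] s := by
    intro s
    rw [Measure.smul_apply, smul_eq_mul, hTe, ENNReal.ofReal_inv_of_pos hT0]
  refine ⟨⟨?_⟩, ⟨⟨T⁻¹ * c₂ + (ρ ^ D)⁻¹, by positivity, fun x r hr => ?_⟩,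
    ⟨T⁻¹ * (c₁ * (min ρ 1) ^ D), by positivity, fun x r hr hr1 => ?_⟩⟩⟩
  · rw [hsm, hTe]
    exact ENNReal.mul_lt_top ENNReal.ofReal_lt_top ENNReal.ofReal_lt_top
  · rw [hsm]
    rcases le_or_gt r ρ with hle | hlt
    · refine (mul_le_mul_right (hb x r hr hle).2 _).trans ?_
      rw [← ENNReal.ofReal_mul (by positivity)]
      refine ENNReal.ofReal_le_ofReal ?_
      have : 0 ≤ (ρ ^ D)⁻¹ * r ^ D := by positivity
      nlinarith
    · refine (mul_le_mul_right (measure_mono (Set.subset_univ _)) _).trans ?_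
      rw [hTe, ← ENNReal.ofReal_mul (by positivity)]
      refine ENNReal.ofReal_le_ofReal ?_
      have h1 : 1 ≤ (ρ ^ D)⁻¹ * r ^ D := by
        rw [← div_eq_inv_mul, one_le_div (by positivity)]
        exact pow_le_pow_left₀ hρ.le hlt.le _
      have h2 : 0 ≤ T⁻¹ * c₂ * r ^ D := by positivity
      have h3 : T⁻¹ * T = 1 := inv_mul_cancel₀ hT0.ne'
      nlinarith
  · rw [hsm, mul_assoc, ENNReal.ofReal_mul (by positivity), mul_assoc, ← mul_pow]
    have hq : 0 < min ρ 1 := by positivity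
    have hle : min ρ 1 * r ≤ ρ := by nlinarith [min_le_left ρ 1]
    refine mul_le_mul_right ((hb x _ (by positivity) hle).1.trans (measure_mono ?_)) _
    exact ball_subset_ball (by nlinarith [min_le_right ρ 1])

end Charts

/-! ### Comparison of distances, and the energy bound for spaces with charts -/

section Final

open Metric

/-- For `θ` the arccosine, `1 - θ² / 2 ≤ cos θ ≤ 1 - 2 θ² / π²`. The parameter `κ` is `1/2` for the
Euclidean distance on the sphere and `1` for the Frobenius distance. -/
theorem le_arccos_and_arccos_le {κ ρ : ℝ} (hκ : 1 / 2 ≤ κ) (hκ' : κ ≤ 1) (hρ : 0 ≤ ρ)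
    (hρ' : ρ ≤ 2) :
    ρ ≤ Real.arccos (1 - κ * ρ ^ 2) ∧ Real.arccos (1 - κ * ρ ^ 2) ≤ 4 * ρ := by
  have h0 := Real.arccos_nonneg (1 - κ * ρ ^ 2)
  have hpi := Real.arccos_le_pi (1 - κ * ρ ^ 2)
  have hup : 1 - κ * ρ ^ 2 ≤ 1 := by nlinarith [sq_nonneg ρ]
  rcases le_or_gt (-1) (1 - κ * ρ ^ 2) with hl | hl
  · have hcos := Real.cos_arccos hl hup
    have h1 := Real.one_sub_sq_div_two_le_cos (x := Real.arccos (1 - κ * ρ ^ 2))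
  
    have h3 := Real.cos_le_one_sub_mul_cos_sq (x := Real.arccos (1 - κ * ρ ^ 2))
      (by rwa [abs_of_nonneg h0])
    rw [hcos] at h1 h3
    constructor
    · refine abs_le_of_sq_le_sq' ?_ h0 |>.2
      nlinarith [sq_nonneg ρ]
    · refine abs_le_of_sq_le_sq' ?_ (by positivity) |>.2
      have h4 : (1 / 8 : ℝ) ≤ 2 / Real.pi ^ 2 := by
        rw [div_le_div_iff₀ (by norm_num) (by positivity)]
        nlinarith [Real.pi_le_four, Real.pi_pos]
      nlinarith [sq_nonneg ρ, sq_nonneg (Real.arccos (1 - κ * ρ ^ 2))]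
  -- The bound `ρ ≤ 2` alone does not keep the argument above `-1`; below it `Real.arccos` is
  -- constantly `π`.
  · rw [Real.arccos_of_le_neg_one hl.le]
    refine ⟨by linarith [Real.pi_gt_three], ?_⟩
    have : 1 < ρ := by nlinarith
    linarith [Real.pi_le_four]

theorem TwoPointSpace.energy_bound_of_charts (Ω : TwoPointSpace) {E : Type*}
    [NormedAddCommGroup E] [NormedSpace ℝ E] [FiniteDimensional ℝ E]
    (hE : Module.finrank ℝ E = Ω.dim) (hdim : 1 ≤ Ω.dim)
    (hch : HasUniformCharts Ω.Point E) (htb : TotallyBounded (Set.univ : Set Ω.Point))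
    {κ : ℝ} (hκ : 1 / 2 ≤ κ) (hκ' : κ ≤ 1)
    (hgeo : ∀ x y, Ω.geodist x y = Real.arccos (1 - κ * dist x y ^ 2))
    (hdiam : ∀ x y : Ω.Point, dist x y ≤ 2)
    (s : ℝ) (hs0 : 0 ≤ s) (hsD : s < (Ω.dim : ℝ)) :
    ∃ A C : ℝ, 0 < A ∧ 0 < C ∧ ∀ ε : ℝ, 0 < ε → ∀ x y : Ω.Point,
      (0 < s →
        (Ω.uniform (Ω.geoBall ε x) * Ω.uniform (Ω.geoBall ε y))⁻¹ *
            (∫⁻ u in Ω.geoBall ε x, ∫⁻ v in Ω.geoBall ε y,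
              ENNReal.ofReal (Ω.geodist u v) ^ (-s) ∂Ω.uniform ∂Ω.uniform)
          ≤ ENNReal.ofReal C * ENNReal.ofReal (Ω.geodist x y) ^ (-s)) ∧
      (s = 0 →
        IntegrableOn (fun p : Ω.Point × Ω.Point => -Real.log (Ω.geodist p.1 p.2))
          (Ω.geoBall ε x ×ˢ Ω.geoBall ε y) (Ω.uniform.prod Ω.uniform) ∧
        (x ≠ y →
          (Ω.uniform.real (Ω.geoBall ε x) * Ω.uniform.real (Ω.geoBall ε y))⁻¹ *
              (∫ u in Ω.geoBall ε x, ∫ v in Ω.geoBall ε y,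
                -Real.log (Ω.geodist u v) ∂Ω.uniform ∂Ω.uniform)
            ≤ A - C * Real.log (Ω.geodist x y))) := by
  -- If there were no points the claim would be vacuous, so no point has to be exhibited.
  rcases isEmpty_or_nonempty Ω.Point with hemp | hne
  · exact ⟨1, 1, one_pos, one_pos, fun ε _ x => hemp.elim x⟩
  have : Nontrivial E := Module.nontrivial_of_finrank_pos (R := ℝ) (by omega)
  obtain ⟨hfin, hreg⟩ := hch.normalized_hausdorffMeasure hE htb
  change IsFiniteMeasure Ω.uniform at hfin
  change AhlforsRegular Ω.uniform Ω.dim at hreg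
  have : SecondCountableTopology Ω.Point := by
    have : TopologicalSpace.SeparableSpace Ω.Point :=
      TopologicalSpace.isSeparable_univ_iff.1 htb.isSeparable
    exact UniformSpace.secondCountable_of_separable _
  have hϑ : ∀ x y : Ω.Point, dist x y ≤ Ω.geodist x y := fun x y => by
    rw [hgeo]; exact (le_arccos_and_arccos_le hκ hκ' dist_nonneg (hdiam x y)).1
  have hϑ' : ∀ x y : Ω.Point, Ω.geodist x y ≤ 4 * dist x y := fun x y => by
    rw [hgeo]; exact (le_arccos_and_arccos_le hκ hκ' dist_nonneg (hdiam x y)).2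
  have hcont : Continuous fun p : Ω.Point × Ω.Point => Ω.geodist p.1 p.2 := by
    simp_rw [hgeo]
    exact Real.continuous_arccos.comp (by fun_prop)
  have hmeas : ∀ ε x, MeasurableSet {z | Ω.geodist z x < ε} := fun ε x =>
    (isOpen_lt (hcont.comp (continuous_id.prodMk continuous_const)) continuous_const).measurableSet
  rcases hs0.eq_or_lt with rfl | hs
  · obtain ⟨A, hA, h⟩ := hreg.exists_average_log_le hdim hϑ hϑ' hdiam hcont
    refine ⟨A, 1, hA, one_pos, fun ε hε x y => ⟨fun h0 => (lt_irrefl _ h0).elim, fun _ => ?_⟩⟩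
    rw [one_mul]
    exact h ε hε x y
  · obtain ⟨C, hC, h⟩ := hreg.exists_average_rpow_neg_le hdim hϑ hϑ' hdiam hmeas hs hsD
    exact ⟨1, C, one_pos, hC, fun ε hε x y => ⟨fun _ => h ε hε x y, fun h0 => (hs.ne' h0).elim⟩⟩

end Final

/-- The properties of the multiplication and conjugation of a real composition algebra that do not
involve associativity. -/
structure IsCompositionAlgebra (F : Type) [NormedAddCommGroup F] [InnerProductSpace ℝ F] [Mul F]
    [One F] [Star F] : Prop where
  add_mul : ∀ a b c : F, (a + b) * c = a * c + b * c
  mul_add : ∀ a b c : F, a * (b + c) = a * b + a * c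
  smul_mul : ∀ (t : ℝ) (a b : F), (t • a) * b = t • (a * b)
  mul_smul : ∀ (t : ℝ) (a b : F), a * (t • b) = t • (a * b)
  mul_one : ∀ a : F, a * 1 = a
  star_add : ∀ a b : F, star (a + b) = star a + star b
  star_smul : ∀ (t : ℝ) (a : F), star (t • a) = t • star a
  star_star : ∀ a : F, star (star a) = a
  star_mul : ∀ a b : F, star (a * b) = star b * star a
  star_one : star (1 : F) = 1
  norm_one : ‖(1 : F)‖ = 1
  norm_mul : ∀ a b : F, ‖a * b‖ = ‖a‖ * ‖b‖
  norm_star : ∀ a : F, ‖star a‖ = ‖a‖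
  mul_star_self : ∀ a : F, a * star a = (‖a‖ ^ 2) • (1 : F)
  inner_mul : ∀ a b c : F, inner ℝ (a * b) c = inner ℝ b (star a * c)
  inner_one_mul_star : ∀ a b : F, inner ℝ (1 : F) (a * star b) = inner ℝ a b


/-! ### Projective spaces: rank-one structure and affine charts -/

namespace ProjSpace

open Metric

variable {F : Type} [NormedAddCommGroup F] [Mul F] [One F] [Star F] {d : ℕ}

theorem star_apply (P : ProjSpace F d) (i j : Fin (d + 1)) : star (P.1 j i) = P.1 i j :=
  P.2.1.apply i j

theorem sum_mul_apply (P : ProjSpace F d) (i j : Fin (d + 1)) :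
    ∑ k, P.1 i k * P.1 k j = P.1 i j := by
  have := congrFun (congrFun P.2.2.1 i) j
  rwa [Matrix.mul_apply] at this

theorem dist_sq_eq (P Q : ProjSpace F d) :
    dist P Q ^ 2 = ∑ i, ∑ j, ‖P.1 i j - Q.1 i j‖ ^ 2 := by
  have h : dist P Q = ‖entries P - entries Q‖ := (dist_eq_norm (entries P) (entries Q))
  rw [h, PiLp.norm_sq_eq_of_L2, Fintype.sum_prod_type]
  rfl

theorem norm_sub_apply_le_dist (P Q : ProjSpace F d) (i j : Fin (d + 1)) :
    ‖P.1 i j - Q.1 i j‖ ≤ dist P Q := by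
  have h : dist P Q = ‖entries P - entries Q‖ := (dist_eq_norm (entries P) (entries Q))
  rw [h]
  exact PiLp.norm_apply_le (entries P - entries Q) (i, j)

theorem dist_le_of_norm_sub_apply_le (P Q : ProjSpace F d) {B : ℝ}
    (h : ∀ i j, ‖P.1 i j - Q.1 i j‖ ≤ B) : dist P Q ≤ (d + 1) * B := by
  have hB : 0 ≤ B := (norm_nonneg _).trans (h 0 0)
  refine abs_le_of_sq_le_sq' ?_ (by positivity) |>.2
  rw [dist_sq_eq]
  calc ∑ i, ∑ j, ‖P.1 i j - Q.1 i j‖ ^ 2 ≤ ∑ _i : Fin (d + 1), ∑ _j : Fin (d + 1), B ^ 2 := by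
        gcongr with i _ j _; exact h i j
    _ = ((d + 1) * B) ^ 2 := by simp; ring

/-- The squared norm of the `k`-th row; it is the `k`-th diagonal entry. -/
def weight (P : ProjSpace F d) (k : Fin (d + 1)) : ℝ := ∑ j, ‖P.1 k j‖ ^ 2

theorem weight_nonneg (P : ProjSpace F d) (k : Fin (d + 1)) : 0 ≤ weight P k :=
  Finset.sum_nonneg fun _ _ => by positivity

variable [InnerProductSpace ℝ F] (hF : IsCompositionAlgebra F)

/-- The homogeneous coordinates of the line of `P`, normalized to have `k`-th coordinate `1`. -/
noncomputable def homogeneousCoord (P : ProjSpace F d) (k i : Fin (d + 1)) : F :=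
  (weight P k)⁻¹ • P.1 i k

/-- The `k`-th affine chart. -/
noncomputable def affineChart (k : Fin (d + 1)) (P : ProjSpace F d) : Fin d → F :=
  fun i => homogeneousCoord P k (k.succAbove i)

include hF

theorem norm_apply_symm (P : ProjSpace F d) (i j : Fin (d + 1)) : ‖P.1 i j‖ = ‖P.1 j i‖ := by
  rw [← star_apply P i j, hF.norm_star]

theorem sum_norm_sq_column (P : ProjSpace F d) (k : Fin (d + 1)) :
    ∑ i, ‖P.1 i k‖ ^ 2 = weight P k := by
  simp_rw [norm_apply_symm hF P _ k]; rfl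

/-- The diagonal of `P = P P*`. With the trace condition it makes the Frobenius norm of `P` equal to
one. -/
theorem apply_self (P : ProjSpace F d) (k : Fin (d + 1)) : P.1 k k = weight P k • (1 : F) := by
  rw [← sum_mul_apply P k k, weight, Finset.sum_smul]
  refine Finset.sum_congr rfl fun j _ => ?_
  rw [← hF.mul_star_self, star_apply]

theorem sum_weight (P : ProjSpace F d) : ∑ k, weight P k = 1 := by
  have h := P.2.2.2
  simp only [Matrix.trace, Matrix.diag_apply, apply_self hF] at h
  rw [← Finset.sum_smul] at h
  have h2 := congrArg (fun z : F => ‖z‖) h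
  simp only [norm_smul, hF.norm_one, mul_one] at h2
  rwa [Real.norm_of_nonneg (Finset.sum_nonneg fun k _ => weight_nonneg P k)] at h2

theorem weight_le_one (P : ProjSpace F d) (k : Fin (d + 1)) : weight P k ≤ 1 := by
  rw [← sum_weight hF P]
  exact Finset.single_le_sum (fun k _ => weight_nonneg P k) (Finset.mem_univ k)

theorem norm_apply_le_one (P : ProjSpace F d) (i k : Fin (d + 1)) : ‖P.1 i k‖ ≤ 1 := by
  have h1 : ‖P.1 i k‖ ^ 2 ≤ weight P i :=
    Finset.single_le_sum (f := fun k => ‖P.1 i k‖ ^ 2) (fun _ _ => by positivity)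
      (Finset.mem_univ k)
  nlinarith [weight_le_one hF P i, norm_nonneg (P.1 i k)]

theorem exists_le_weight (P : ProjSpace F d) : ∃ k, 1 / ((d : ℝ) + 1) ≤ weight P k := by
  by_contra! h
  have h1 : ∑ k, weight P k < ∑ _k : Fin (d + 1), 1 / ((d : ℝ) + 1) :=
    Finset.sum_lt_sum_of_nonempty Finset.univ_nonempty fun k _ => h k
  rw [sum_weight hF, Finset.sum_const, Finset.card_univ, Fintype.card_fin, nsmul_eq_mul] at h1
  push_cast at h1
  rw [mul_one_div_cancel (by positivity)] at h1
  exact lt_irrefl _ h1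

/-- The matrix `P` has rank one: no associativity is needed. -/
theorem weight_smul_apply (P : ProjSpace F d) (i j k : Fin (d + 1)) :
    weight P k • P.1 i j = P.1 i k * P.1 k j := by
  set a := weight P k with ha
  -- Moving `P i k` across the inner product turns it into `P k i`, and idempotence then collapses
  -- the sum over `i` to `P k j`.
  have hcross : ∑ i, ∑ j, inner ℝ (P.1 i j) (P.1 i k * P.1 k j) = a := by
    rw [Finset.sum_comm, ha, weight]
    refine Finset.sum_congr rfl fun j _ => ?_
    have h1 : ∀ i, inner ℝ (P.1 i j) (P.1 i k * P.1 k j) =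
        inner ℝ (P.1 k i * P.1 i j) (P.1 k j) := fun i => by
      rw [hF.inner_mul, star_apply]
    simp_rw [h1]
    rw [← sum_inner, sum_mul_apply, real_inner_self_eq_norm_sq]
  have hP : ∑ i, ∑ j, ‖P.1 i j‖ ^ 2 = 1 := sum_weight hF P
  have hQ : ∑ i, ∑ j, ‖P.1 i k * P.1 k j‖ ^ 2 = a * a := by
    simp_rw [hF.norm_mul, mul_pow, ← Finset.mul_sum]
    rw [← Finset.sum_mul, sum_norm_sq_column hF, ← weight]
  -- The squared norm of `a P - (column k)(row k)` is `a² - 2 a · a + a² = 0`.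
  have hzero : ∑ i, ∑ j, ‖a • P.1 i j - P.1 i k * P.1 k j‖ ^ 2 = 0 := by
    simp_rw [norm_sub_sq_real, norm_smul, mul_pow, real_inner_smul_left, Finset.sum_add_distrib,
      Finset.sum_sub_distrib, ← Finset.mul_sum]
    rw [hP, hQ, hcross, Real.norm_eq_abs, sq_abs]
    ring
  have h1 := (Finset.sum_eq_zero_iff_of_nonneg
    fun i _ => Finset.sum_nonneg fun j _ => by positivity).1 hzero i (Finset.mem_univ i)
  have h2 := (Finset.sum_eq_zero_iff_of_nonneg fun j _ => by positivity).1 h1 j (Finset.mem_univ j)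
  exact sub_eq_zero.1 (norm_eq_zero.1 (pow_eq_zero_iff two_ne_zero |>.1 h2))

theorem inner_one_trace_mul (P Q : ProjSpace F d) :
    inner ℝ (1 : F) (P.1 * Q.1).trace = ∑ i, ∑ j, inner ℝ (P.1 i j) (Q.1 i j) := by
  simp only [Matrix.trace, Matrix.diag_apply, Matrix.mul_apply, inner_sum]
  refine Finset.sum_congr rfl fun i _ => Finset.sum_congr rfl fun j _ => ?_
  rw [← star_apply Q j i, hF.inner_one_mul_star]

theorem dist_sq_eq_sub_inner (P Q : ProjSpace F d) :
    dist P Q ^ 2 = 2 - 2 * inner ℝ (1 : F) (P.1 * Q.1).trace := by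
  have hP : ∑ i, ∑ j, ‖P.1 i j‖ ^ 2 = 1 := sum_weight hF P
  have hQ : ∑ i, ∑ j, ‖Q.1 i j‖ ^ 2 = 1 := sum_weight hF Q
  rw [dist_sq_eq, inner_one_trace_mul hF]
  simp_rw [norm_sub_sq_real, Finset.sum_add_distrib, Finset.sum_sub_distrib, ← Finset.mul_sum]
  rw [hP, hQ]; ring

/-- Both projections have Frobenius norm one, so `‖P - Q‖² = 2 - 2 Re Tr (P Q)`. The factor 1 is the
parameter `κ`. -/
theorem geodist_eq (P Q : ProjSpace F d) :
    geodist P Q = Real.arccos (1 - 1 * dist P Q ^ 2) := by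
  rw [geodist, dist_sq_eq_sub_inner hF]
  congr 1; ring

theorem norm_entries (P : ProjSpace F d) : ‖entries P‖ = 1 := by
  have h : ‖entries P‖ ^ 2 = 1 := by
    rw [PiLp.norm_sq_eq_of_L2, Fintype.sum_prod_type]
    exact sum_weight hF P
  exact (pow_eq_one_iff_of_nonneg (norm_nonneg _) two_ne_zero).1 h

theorem dist_le_two (P Q : ProjSpace F d) : dist P Q ≤ 2 := by
  have h : dist P Q = ‖entries P - entries Q‖ := (dist_eq_norm (entries P) (entries Q))
  rw [h]
  refine (norm_sub_le _ _).trans ?_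
  rw [norm_entries hF, norm_entries hF]; norm_num

/-- The entries embed the space isometrically in the closed unit ball of a finite-dimensional space.
-/
theorem totallyBounded_univ [FiniteDimensional ℝ F] :
    TotallyBounded (Set.univ : Set (ProjSpace F d)) := by
  have hiso : Isometry (entries : ProjSpace F d → _) := Isometry.of_dist_eq fun _ _ => rfl
  have : ProperSpace (PiLp 2 (fun _ : Fin (d + 1) × Fin (d + 1) => F)) :=
    FiniteDimensional.proper ℝ _
  have h := totallyBounded_preimage hiso.isUniformInducing
    (isCompact_closedBall (0 : PiLp 2 (fun _ : Fin (d + 1) × Fin (d + 1) => F)) 1).totallyBounded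
  refine h.subset fun P _ => ?_
  simp [norm_entries hF]

theorem homogeneousCoord_self (P : ProjSpace F d) {k : Fin (d + 1)} (hk : 0 < weight P k) :
    homogeneousCoord P k k = 1 := by
  rw [homogeneousCoord, apply_self hF, smul_smul, inv_mul_cancel₀ hk.ne', one_smul]

theorem sum_norm_sq_homogeneousCoord (P : ProjSpace F d) {k : Fin (d + 1)}
    (hk : 0 < weight P k) : ∑ i, ‖homogeneousCoord P k i‖ ^ 2 = (weight P k)⁻¹ := by
  simp_rw [homogeneousCoord, norm_smul, mul_pow, ← Finset.mul_sum, sum_norm_sq_column hF]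
  rw [Real.norm_of_nonneg (by positivity)]
  field_simp

/-- The rank-one factorization in homogeneous coordinates; it recovers `P` from its affine chart and
so controls the inverse of the chart. -/
theorem apply_eq_smul_homogeneousCoord (P : ProjSpace F d) {k : Fin (d + 1)}
    (hk : 0 < weight P k) (i j : Fin (d + 1)) :
    P.1 i j = weight P k • (homogeneousCoord P k i * star (homogeneousCoord P k j)) := by
  rw [homogeneousCoord, homogeneousCoord, hF.star_smul, hF.smul_mul, hF.mul_smul, star_apply,
    ← weight_smul_apply hF, smul_smul, smul_smul, smul_smul]
  rw [show weight P k * (weight P k)⁻¹ * (weight P k)⁻¹ * weight P k = 1 by field_simp, one_smul]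

theorem norm_homogeneousCoord_le (P : ProjSpace F d) {k : Fin (d + 1)} {δ : ℝ} (hδ : 0 < δ)
    (hk : δ ≤ weight P k) (i : Fin (d + 1)) : ‖homogeneousCoord P k i‖ ≤ δ⁻¹ := by
  have hk0 := hδ.trans_le hk
  rw [homogeneousCoord, norm_smul, Real.norm_of_nonneg (by positivity)]
  calc (weight P k)⁻¹ * ‖P.1 i k‖ ≤ δ⁻¹ * 1 := by
        gcongr; exact norm_apply_le_one hF P i k
    _ = δ⁻¹ := mul_one _

theorem abs_weight_sub_le (P Q : ProjSpace F d) (k : Fin (d + 1)) :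
    |weight P k - weight Q k| ≤ dist P Q := by
  have h := norm_sub_apply_le_dist P Q k k
  rwa [apply_self hF, apply_self hF, ← sub_smul, norm_smul, hF.norm_one, mul_one] at h

theorem dist_affineChart_le (P Q : ProjSpace F d) {k : Fin (d + 1)} {δ : ℝ} (hδ : 0 < δ)
    (hP : δ ≤ weight P k) (hQ : δ ≤ weight Q k) :
    dist (affineChart k P) (affineChart k Q) ≤ (δ⁻¹ + δ⁻¹ ^ 2) * dist P Q := by
  have hP0 := hδ.trans_le hP
  have hQ0 := hδ.trans_le hQ
  refine (dist_pi_le_iff (by positivity)).2 fun i => ?_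
  rw [dist_eq_norm, affineChart, affineChart, homogeneousCoord, homogeneousCoord]
  set p := P.1 (k.succAbove i) k
  set q := Q.1 (k.succAbove i) k
  have h1 : (weight P k)⁻¹ • p - (weight Q k)⁻¹ • q =
      (weight P k)⁻¹ • (p - q) + ((weight P k)⁻¹ - (weight Q k)⁻¹) • q := by
    rw [smul_sub, sub_smul]; abel
  have h2 : |(weight P k)⁻¹ - (weight Q k)⁻¹| ≤ δ⁻¹ ^ 2 * dist P Q := by
    rw [show (weight P k)⁻¹ - (weight Q k)⁻¹ =
      (weight P k)⁻¹ * (weight Q k)⁻¹ * (weight Q k - weight P k) by field_simp, abs_mul,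
      abs_of_pos (by positivity), sq]
    gcongr
    rw [abs_sub_comm]
    exact abs_weight_sub_le hF P Q k
  rw [h1]
  calc _ ≤ (weight P k)⁻¹ * ‖p - q‖ + |(weight P k)⁻¹ - (weight Q k)⁻¹| * ‖q‖ := by
        refine (norm_add_le _ _).trans (le_of_eq ?_)
        rw [norm_smul, norm_smul, Real.norm_of_nonneg (by positivity), Real.norm_eq_abs]
    _ ≤ δ⁻¹ * dist P Q + δ⁻¹ ^ 2 * dist P Q * 1 := by
        gcongr
        · exact norm_sub_apply_le_dist P Q _ _
        · exact norm_apply_le_one hF Q _ _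
    _ = _ := by ring

theorem norm_homogeneousCoord_sub_le (P Q : ProjSpace F d) {k : Fin (d + 1)}
    (hP : 0 < weight P k) (hQ : 0 < weight Q k) (i : Fin (d + 1)) :
    ‖homogeneousCoord P k i - homogeneousCoord Q k i‖ ≤
      dist (affineChart k P) (affineChart k Q) := by
  rcases Fin.eq_self_or_eq_succAbove k i with rfl | ⟨j, rfl⟩
  · rw [homogeneousCoord_self hF P hP, homogeneousCoord_self hF Q hQ, sub_self, norm_zero]
    exact dist_nonneg
  · rw [← dist_eq_norm]
    exact dist_le_pi_dist (affineChart k P) (affineChart k Q) j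

/-- The inverse of the weight is the sum of the squared homogeneous coordinates, hence Lipschitz
where these are bounded by `δ⁻¹`; inverting back loses nothing as weights are at most one. -/
theorem abs_weight_sub_le_dist_affineChart (P Q : ProjSpace F d) {k : Fin (d + 1)} {δ : ℝ}
    (hδ : 0 < δ) (hP : δ ≤ weight P k) (hQ : δ ≤ weight Q k) :
    |weight P k - weight Q k| ≤
      (d + 1) * (2 * δ⁻¹) * dist (affineChart k P) (affineChart k Q) := by
  have hP0 := hδ.trans_le hP
  have hQ0 := hδ.trans_le hQ
  set η := dist (affineChart k P) (affineChart k Q)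
  have h1 : |(weight Q k)⁻¹ - (weight P k)⁻¹| ≤ (d + 1) * (2 * δ⁻¹) * η := by
    rw [← sum_norm_sq_homogeneousCoord hF P hP0, ← sum_norm_sq_homogeneousCoord hF Q hQ0,
      ← Finset.sum_sub_distrib]
    refine (Finset.abs_sum_le_sum_abs _ _).trans ?_
    have h2 : ∀ i ∈ (Finset.univ : Finset (Fin (d + 1))),
        |‖homogeneousCoord Q k i‖ ^ 2 - ‖homogeneousCoord P k i‖ ^ 2| ≤ 2 * δ⁻¹ * η := by
      intro i _
      rw [sq_sub_sq, abs_mul, abs_of_nonneg (by positivity)]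
      have h3 := norm_homogeneousCoord_le hF P hδ hP i
      have h4 := norm_homogeneousCoord_le hF Q hδ hQ i
      have h5 := (abs_norm_sub_norm_le _ _).trans (norm_homogeneousCoord_sub_le hF P Q hP0 hQ0 i)
      rw [abs_sub_comm] at h5
      gcongr
      linarith
    refine (Finset.sum_le_card_nsmul _ _ _ h2).trans (le_of_eq ?_)
    rw [Finset.card_univ, Fintype.card_fin, nsmul_eq_mul]; push_cast; ring
  calc |weight P k - weight Q k|
      = weight P k * weight Q k * |(weight Q k)⁻¹ - (weight P k)⁻¹| := by
        rw [show weight P k - weight Q k =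
          weight P k * weight Q k * ((weight Q k)⁻¹ - (weight P k)⁻¹) by field_simp, abs_mul,
          abs_of_pos (mul_pos hP0 hQ0)]
    _ ≤ 1 * 1 * |(weight Q k)⁻¹ - (weight P k)⁻¹| := by
        gcongr
        · exact weight_le_one hF P k
        · exact weight_le_one hF Q k
    _ ≤ _ := by rw [one_mul, one_mul]; exact h1

theorem dist_le_dist_affineChart (P Q : ProjSpace F d) {k : Fin (d + 1)} {δ : ℝ} (hδ : 0 < δ)
    (hP : δ ≤ weight P k) (hQ : δ ≤ weight Q k) :
    dist P Q ≤ (d + 1) * ((d + 1) * (2 * δ⁻¹) * δ⁻¹ ^ 2 + 2 * δ⁻¹) *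
      dist (affineChart k P) (affineChart k Q) := by
  have hP0 := hδ.trans_le hP
  have hQ0 := hδ.trans_le hQ
  rw [mul_assoc]
  refine dist_le_of_norm_sub_apply_le P Q fun i j => ?_
  have hw := abs_weight_sub_le_dist_affineChart hF P Q hδ hP hQ
  set η := dist (affineChart k P) (affineChart k Q)
  have hη : 0 ≤ η := dist_nonneg
  rw [apply_eq_smul_homogeneousCoord hF P hP0, apply_eq_smul_homogeneousCoord hF Q hQ0]
  have hp := norm_homogeneousCoord_le hF P hδ hP
  have hq := norm_homogeneousCoord_le hF Q hδ hQ
  have hpq := norm_homogeneousCoord_sub_le hF P Q hP0 hQ0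
  set p := homogeneousCoord P k
  set q := homogeneousCoord Q k
  -- Telescoping of the product `weight · p i · star (p j)`, one factor at a time.
  have hsplit : weight P k • (p i * star (p j)) - weight Q k • (q i * star (q j)) =
      (weight P k - weight Q k) • (p i * star (p j)) +
        weight Q k • ((p i - q i) * star (p j) + q i * star (p j - q j)) := by
    have e1 : (p i - q i) * star (p j) = p i * star (p j) - q i * star (p j) := by
      rw [eq_sub_iff_add_eq, ← hF.add_mul, sub_add_cancel]
    have e2 : q i * star (p j - q j) = q i * star (p j) - q i * star (q j) := by
      rw [eq_sub_iff_add_eq, ← hF.mul_add, ← hF.star_add, sub_add_cancel]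
    rw [e1, e2, sub_smul, sub_add_sub_cancel, smul_sub]
    abel
  rw [hsplit]
  calc _ ≤ |weight P k - weight Q k| * (‖p i‖ * ‖p j‖) +
        weight Q k * (‖p i - q i‖ * ‖p j‖ + ‖q i‖ * ‖p j - q j‖) := by
        refine (norm_add_le _ _).trans ?_
        rw [norm_smul, norm_smul, Real.norm_eq_abs, Real.norm_of_nonneg hQ0.le, hF.norm_mul,
          hF.norm_star]
        gcongr
        refine (norm_add_le _ _).trans (le_of_eq ?_)
        rw [hF.norm_mul, hF.norm_mul, hF.norm_star, hF.norm_star]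
    _ ≤ (d + 1) * (2 * δ⁻¹) * η * (δ⁻¹ * δ⁻¹) + 1 * (η * δ⁻¹ + δ⁻¹ * η) := by
        gcongr
        · exact hp i
        · exact hp j
        · exact weight_le_one hF Q k
        · exact hpq i
        · exact hp j
        · exact hq i
        · exact hpq j
    _ = _ := by ring

/-- The projection onto the line spanned by a vector with some coordinate equal to one. -/
theorem exists_affineChart_eq
    (hassoc : ∀ v : Fin (d + 1) → F, (∃ k, v k = 1) → ∀ i j k,
      (v i * star (v k)) * (v k * star (v j)) = (‖v k‖ ^ 2) • (v i * star (v j)))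
    (k : Fin (d + 1)) (w : Fin d → F) :
    ∃ Q : ProjSpace F d, weight Q k = (1 + ∑ i, ‖w i‖ ^ 2)⁻¹ ∧ affineChart k Q = w := by
  set v : Fin (d + 1) → F := k.insertNth 1 w with hv
  have hvk : v k = 1 := by simp [hv]
  have hvi : ∀ i, v (k.succAbove i) = w i := fun i => by simp [hv]
  set n : ℝ := ∑ i, ‖v i‖ ^ 2 with hn
  have hn1 : n = 1 + ∑ i, ‖w i‖ ^ 2 := by
    rw [hn, Fin.sum_univ_succAbove _ k, hvk, hF.norm_one, one_pow]
    simp_rw [hvi]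
  have hn0 : 0 < n := by
    rw [hn1]
    have : 0 ≤ ∑ i, ‖w i‖ ^ 2 := Finset.sum_nonneg fun _ _ => by positivity
    linarith
  set M : Matrix (Fin (d + 1)) (Fin (d + 1)) F := Matrix.of fun i j => n⁻¹ • (v i * star (v j))
    with hM
  have hherm : M.IsHermitian := by
    ext i j
    rw [Matrix.conjTranspose_apply, hM, Matrix.of_apply, Matrix.of_apply, hF.star_smul,
      hF.star_mul, hF.star_star]
  -- The only use of the associativity hypothesis. It is restricted to vectors with a coordinate
  -- equal to one, since it fails for general octonion vectors.
  have hidem : M * M = M := by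
    ext i j
    simp only [Matrix.mul_apply, hM, Matrix.of_apply]
    simp_rw [hF.smul_mul, hF.mul_smul, hassoc v ⟨k, hvk⟩, smul_smul]
    rw [← Finset.sum_smul, ← Finset.mul_sum, ← Finset.mul_sum, ← hn]
    congr 1
    field_simp
  have htr : M.trace = 1 := by
    simp only [Matrix.trace, Matrix.diag_apply, hM, Matrix.of_apply]
    simp_rw [hF.mul_star_self, smul_smul]
    rw [← Finset.sum_smul, ← Finset.mul_sum, ← hn, inv_mul_cancel₀ hn0.ne', one_smul]
  set Q : ProjSpace F d := ⟨M, hherm, hidem, htr⟩ with hQ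
  have hwt : weight Q k = n⁻¹ := by
    simp only [weight, hQ, hM, Matrix.of_apply, hvk]
    simp_rw [norm_smul, hF.norm_mul, hF.norm_star, hF.norm_one, one_mul, mul_pow,
      ← Finset.mul_sum]
    rw [← hn, Real.norm_of_nonneg (by positivity)]
    field_simp
  refine ⟨Q, by rw [hwt, hn1], ?_⟩
  funext i
  rw [affineChart, homogeneousCoord, hwt]
  simp only [hQ, hM, Matrix.of_apply]
  rw [hvk, hF.star_one, hF.mul_one, hvi, smul_smul, inv_inv, mul_inv_cancel₀ hn0.ne', one_smul]

theorem hasUniformCharts (hd : 1 ≤ d)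
    (hassoc : ∀ v : Fin (d + 1) → F, (∃ k, v k = 1) → ∀ i j k,
      (v i * star (v k)) * (v k * star (v j)) = (‖v k‖ ^ 2) • (v i * star (v j))) :
    HasUniformCharts (ProjSpace F d) (Fin d → F) := by
  have hd' : (1 : ℝ) ≤ d := by exact_mod_cast hd
  set N : ℝ := d + 1 with hN
  -- Some weight of `P` is at least `1 / N`, so the affine coordinates of `P` have norm at most `N`.
  -- Those within distance 1 have norm at most `N + 1`, and the corresponding projection has weight
  -- at least `δ`. As weights are 1-Lipschitz, the ball of radius `1 / N - δ` stays in the domain.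
  set δ : ℝ := (1 + d * (N + 1) ^ 2)⁻¹ with hδ
  have hδ0 : 0 < δ := by positivity
  have hδN : δ < 1 / N := by
    rw [hδ, ← one_div]
    exact one_div_lt_one_div_of_lt (by positivity) (by nlinarith)
  refine ⟨⟨1 / N - δ, 1, ⟨δ⁻¹ + δ⁻¹ ^ 2, by positivity⟩,
    ⟨N * (N * (2 * δ⁻¹) * δ⁻¹ ^ 2 + 2 * δ⁻¹), by positivity⟩, by linarith, one_pos, fun P => ?_⟩⟩
  obtain ⟨k, hk⟩ := exists_le_weight hF P
  have hk0 : 0 < weight P k := lt_of_lt_of_le (by positivity) hk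
  refine ⟨{Q | δ ≤ weight Q k}, affineChart k, fun Q hQ => ?_,
    fun Q hQ R hR => dist_affineChart_le hF Q R hδ0 hQ hR,
    fun Q hQ R hR => dist_le_dist_affineChart hF Q R hδ0 hQ hR, fun w hw => ?_⟩
  · have h1 := abs_weight_sub_le hF Q P k
    rw [mem_ball] at hQ
    show δ ≤ weight Q k
    linarith [(abs_le.1 h1).1]
  · obtain ⟨Q, hQ, rfl⟩ := exists_affineChart_eq hF hassoc k w
    refine ⟨Q, ?_, rfl⟩
    have hw' : ∀ i, ‖affineChart k Q i‖ ≤ N + 1 := fun i => by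
      have h1 : ‖affineChart k Q i - affineChart k P i‖ ≤ 1 := by
        rw [← dist_eq_norm]
        exact (dist_le_pi_dist _ _ i).trans (le_of_lt hw)
      have h2 : ‖affineChart k P i‖ ≤ N := by
        have h3 := sum_norm_sq_homogeneousCoord hF P hk0
        have h4 : ‖affineChart k P i‖ ^ 2 ≤ (weight P k)⁻¹ := by
          rw [← h3]
          exact Finset.single_le_sum (f := fun i => ‖homogeneousCoord P k i‖ ^ 2)
            (fun _ _ => by positivity) (Finset.mem_univ (k.succAbove i))
        have h5 : (weight P k)⁻¹ ≤ N := by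
          rw [inv_le_comm₀ hk0 (by positivity), ← one_div]; exact hk
        nlinarith [norm_nonneg (affineChart k P i)]
      have h6 := norm_sub_norm_le (affineChart k Q i) (affineChart k P i)
      linarith
    show δ ≤ weight Q k
    rw [hQ, hδ]
    refine inv_anti₀ (by positivity) ?_
    have h7 : ∑ i, ‖affineChart k Q i‖ ^ 2 ≤ ∑ _i : Fin d, (N + 1) ^ 2 := by
      gcongr with i _; exact hw' i
    simpa using h7

end ProjSpace

/-! ### The sphere: tangent projections as charts -/

section Sphere

open Metric

theorem real_inner_eq_of_mem_sphere {V : Type*} [NormedAddCommGroup V] [InnerProductSpace ℝ V]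
    (x y : sphere (0 : V) 1) : inner ℝ (x : V) y = 1 - 1 / 2 * dist x y ^ 2 := by
  rw [Subtype.dist_eq, dist_eq_norm, norm_sub_sq_real, norm_eq_of_mem_sphere,
    norm_eq_of_mem_sphere]
  ring

/-- Orthogonal projection to the hyperplane orthogonal to `x`, on the cap `⟨x, y⟩ ≥ 1/2`. It is
1-Lipschitz, and on this cap the heights are controlled by the projections. -/
theorem hasUniformCharts_sphere (d : ℕ) :
    HasUniformCharts (sphere (0 : EuclideanSpace ℝ (Fin (d + 1))) 1)
      (EuclideanSpace ℝ (Fin d)) := by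
  set V := EuclideanSpace ℝ (Fin (d + 1)) with hV
  have : Fact (Module.finrank ℝ V = d + 1) := ⟨finrank_euclideanSpace_fin⟩
  refine ⟨⟨1, 1 / 2, 1, 3, one_pos, by norm_num, fun x => ?_⟩⟩
  have hx : ‖(x : V)‖ = 1 := norm_eq_of_mem_sphere x
  have hxx : inner ℝ (x : V) x = 1 := by rw [real_inner_self_eq_norm_sq, hx, one_pow]
  have hx0 : (x : V) ≠ 0 := norm_ne_zero_iff.1 (by rw [hx]; exact one_ne_zero)
  set e := (OrthonormalBasis.fromOrthogonalSpanSingleton (𝕜 := ℝ) d hx0).repr with he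
  have hmem : ∀ y : V, y - inner ℝ (x : V) y • (x : V) ∈ (Submodule.span ℝ {(x : V)})ᗮ := by
    intro y
    rw [Submodule.mem_orthogonal_singleton_iff_inner_right, inner_sub_right,
      real_inner_smul_right, hxx]
    ring
  set p : V → (Submodule.span ℝ {(x : V)})ᗮ := fun y => ⟨y - inner ℝ (x : V) y • (x : V), hmem y⟩
    with hp
  have hnorm : ∀ y : V, ‖y - inner ℝ (x : V) y • (x : V)‖ ^ 2 =
      ‖y‖ ^ 2 - inner ℝ (x : V) y ^ 2 := by
    intro y
    rw [norm_sub_sq_real, real_inner_smul_right, norm_smul, hx, real_inner_comm, mul_one,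
      Real.norm_eq_abs, sq_abs]
    ring
  have hp1 : ∀ y : sphere (0 : V) 1, ‖p y‖ ^ 2 = 1 - inner ℝ (x : V) y ^ 2 := by
    intro y
    rw [Submodule.coe_norm, hnorm, norm_eq_of_mem_sphere, one_pow]
  have hpd : ∀ y z : V, dist (p y) (p z) ^ 2 =
      dist y z ^ 2 - (inner ℝ (x : V) y - inner ℝ (x : V) z) ^ 2 := by
    intro y z
    rw [dist_eq_norm, dist_eq_norm, ← inner_sub_right, ← hnorm, Submodule.coe_norm]
    congr 2
    simp only [hp, Submodule.coe_sub, inner_sub_right, sub_smul]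
    abel
  refine ⟨{y | 1 / 2 ≤ inner ℝ (x : V) y}, fun y => e (p y), fun y hy => ?_, fun y _ z _ => ?_,
    fun y hy z hz => ?_, fun w hw => ?_⟩
  · rw [mem_ball, dist_comm] at hy
    show 1 / 2 ≤ inner ℝ (x : V) y
    rw [real_inner_eq_of_mem_sphere]
    nlinarith [dist_nonneg (x := x) (y := y)]
  · rw [e.dist_map, NNReal.coe_one, one_mul, Subtype.dist_eq y z]
    refine abs_le_of_sq_le_sq' ?_ dist_nonneg |>.2
    rw [hpd]
    linarith [sq_nonneg (inner ℝ (x : V) y - inner ℝ (x : V) z)]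
  · rw [e.dist_map]
    show dist y z ≤ 3 * dist (p y) (p z)
    have h1 := hpd y z
    have h2 := hp1 y
    have h3 := hp1 z
    rw [Subtype.dist_eq y z]
    have hy' : 1 / 2 ≤ inner ℝ (x : V) y := hy
    have hz' : 1 / 2 ≤ inner ℝ (x : V) z := hz
    have h4 : |‖p z‖ - ‖p y‖| ≤ dist (p y) (p z) := by
      rw [dist_comm, dist_eq_norm]; exact abs_norm_sub_norm_le _ _
    set η := dist (p y) (p z)
    have hη : 0 ≤ η := dist_nonneg
    set t := inner ℝ (x : V) (y : V)
    set t' := inner ℝ (x : V) (z : V)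
    have hy1 : ‖p y‖ ≤ 1 := by nlinarith [norm_nonneg (p y)]
    have hz1 : ‖p z‖ ≤ 1 := by nlinarith [norm_nonneg (p z)]
    -- On the unit sphere `t² - t'²` equals `‖p z‖² - ‖p y‖²`, and `t + t' ≥ 1` on the cap. Then
    -- `dist² ≤ η² + 4 η²`, within the constant `3² = 9`.
    have h5 : |t - t'| ≤ 2 * η := by
      calc |t - t'| ≤ |t - t'| * (t + t') :=
            le_mul_of_one_le_right (abs_nonneg _) (by linarith)
        _ = |‖p z‖ - ‖p y‖| * (‖p z‖ + ‖p y‖) := by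
            have h := congrArg abs (show (t - t') * (t + t') =
              (‖p z‖ - ‖p y‖) * (‖p z‖ + ‖p y‖) by linarith)
            rwa [abs_mul, abs_mul, abs_of_nonneg (by linarith : 0 ≤ t + t'),
              abs_of_nonneg (by positivity : 0 ≤ ‖p z‖ + ‖p y‖)] at h
        _ ≤ η * 2 := by gcongr; linarith
        _ = 2 * η := mul_comm _ _
    have h6 : (t - t') ^ 2 ≤ (2 * η) ^ 2 := sq_le_sq' (by linarith [(abs_le.1 h5).1]) (abs_le.1 h5).2
    refine abs_le_of_sq_le_sq' ?_ (by positivity) |>.2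
    nlinarith
  · have hpx : p x = 0 := by
      apply Subtype.ext
      show (x : V) - inner ℝ (x : V) x • (x : V) = 0
      rw [hxx, one_smul, sub_self]
    have hw1 : ‖w‖ < 1 / 2 := by simpa [hpx] using hw
    set w' : V := ((e.symm w : (Submodule.span ℝ {(x : V)})ᗮ) : V) with hw'
    have hwn : ‖w'‖ = ‖w‖ := by rw [hw', ← Submodule.coe_norm, e.symm.norm_map]
    have horth : inner ℝ (x : V) w' = 0 :=
      Submodule.mem_orthogonal_singleton_iff_inner_right.1 (e.symm w).2
    have hsq : 1 / 4 ≤ 1 - ‖w‖ ^ 2 := by nlinarith [norm_nonneg w]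
    -- The height that lifts `w` back to the sphere; `‖w‖ < 1/2` puts the lift in the cap.
    set t := √(1 - ‖w‖ ^ 2) with ht
    have ht2 : t ^ 2 = 1 - ‖w‖ ^ 2 := Real.sq_sqrt (by linarith)
    have htl : 1 / 2 ≤ t := Real.le_sqrt_of_sq_le (by linarith)
    have hin : inner ℝ (x : V) (w' + t • (x : V)) = t := by
      rw [inner_add_right, real_inner_smul_right, hxx, horth]; ring
    have hunit : ‖w' + t • (x : V)‖ = 1 := by
      have h : ‖w' + t • (x : V)‖ ^ 2 = 1 := by
        rw [norm_add_sq_real, real_inner_smul_right, real_inner_comm, horth, norm_smul, hx, hwn,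
          mul_one, Real.norm_eq_abs, sq_abs, ht2]
        ring
      exact (pow_eq_one_iff_of_nonneg (norm_nonneg _) two_ne_zero).1 h
    refine ⟨⟨w' + t • (x : V), by simpa using hunit⟩, ?_, ?_⟩
    · show 1 / 2 ≤ inner ℝ (x : V) (w' + t • (x : V))
      rw [hin]; exact htl
    · show e (p (w' + t • (x : V))) = w
      have : p (w' + t • (x : V)) = e.symm w := by
        apply Subtype.ext
        show w' + t • (x : V) - inner ℝ (x : V) (w' + t • (x : V)) • (x : V) = w'
        rw [hin, add_sub_cancel_right]
      rw [this, e.apply_symm_apply]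

end Sphere

/-! ### The composition algebras ℝ, ℂ, ℍ, 𝕆 -/

theorem isCompositionAlgebra_real : IsCompositionAlgebra ℝ where
  add_mul := add_mul
  mul_add := mul_add
  smul_mul := smul_mul_assoc
  mul_smul := mul_smul_comm
  mul_one := mul_one
  star_add := star_add
  star_smul t a := by simp
  star_star := star_star
  star_mul := star_mul
  star_one := star_one ℝ
  norm_one := norm_one
  norm_mul := norm_mul
  norm_star := norm_star
  mul_star_self a := by simp [sq]
  inner_mul a b c := by simp; ring
  inner_one_mul_star a b := by simp [mul_comm]

theorem isCompositionAlgebra_complex : IsCompositionAlgebra ℂ where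
  add_mul := add_mul
  mul_add := mul_add
  smul_mul := smul_mul_assoc
  mul_smul := mul_smul_comm
  mul_one := mul_one
  star_add := star_add
  star_smul t a := by simp
  star_star := star_star
  star_mul := star_mul
  star_one := star_one ℂ
  norm_one := norm_one
  norm_mul := norm_mul
  norm_star := norm_star
  mul_star_self a := by
    rw [Complex.star_def, Complex.mul_conj, Complex.normSq_eq_norm_sq, Complex.real_smul, mul_one]
  inner_mul a b c := by simp [Complex.inner]; ring
  inner_one_mul_star a b := by simp [Complex.inner]; ring

theorem isCompositionAlgebra_quaternion : IsCompositionAlgebra (Quaternion ℝ) where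
  add_mul := add_mul
  mul_add := mul_add
  smul_mul := smul_mul_assoc
  mul_smul := mul_smul_comm
  mul_one := mul_one
  star_add := star_add
  star_smul t a := by simp
  star_star := star_star
  star_mul := star_mul
  star_one := star_one _
  norm_one := norm_one
  norm_mul := norm_mul
  norm_star := norm_star
  mul_star_self a := by
    rw [Quaternion.self_mul_star, Quaternion.normSq_eq_norm_mul_self, ← sq, Algebra.smul_def,
      _root_.mul_one, Quaternion.algebraMap_def]
  inner_mul a b c := by simp [Quaternion.inner_def]; ring
  inner_one_mul_star a b := by simp [Quaternion.inner_def]; ring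

namespace Octonion

theorem ext_components {x y : Octonion} (h₁ : x.left = y.left) (h₂ : x.right = y.right) : x = y :=
  (WithLp.ofLp_injective 2) (Prod.ext h₁ h₂)

theorem left_add (x y : Octonion) : (x + y).left = x.left + y.left := rfl
theorem right_add (x y : Octonion) : (x + y).right = x.right + y.right := rfl
theorem left_smul (t : ℝ) (x : Octonion) : (t • x).left = t • x.left := rfl
theorem right_smul (t : ℝ) (x : Octonion) : (t • x).right = t • x.right := rfl
theorem left_mul (x y : Octonion) :
    (x * y).left = x.left * y.left - star y.right * x.right := rfl
theorem right_mul (x y : Octonion) :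
    (x * y).right = y.right * x.left + x.right * star y.left := rfl
theorem left_star (x : Octonion) : (star x).left = star x.left := rfl
theorem right_star (x : Octonion) : (star x).right = -x.right := rfl
theorem left_one : (1 : Octonion).left = 1 := rfl
theorem right_one : (1 : Octonion).right = 0 := rfl

theorem inner_eq (x y : Octonion) :
    inner ℝ x y = inner ℝ x.left y.left + inner ℝ x.right y.right :=
  WithLp.prod_inner_apply (𝕜 := ℝ) (E := Quaternion ℝ) (F := Quaternion ℝ) x y

theorem norm_sq_eq (x : Octonion) :
    ‖x‖ ^ 2 = x.left.re ^ 2 + x.left.imI ^ 2 + x.left.imJ ^ 2 + x.left.imK ^ 2 +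
      (x.right.re ^ 2 + x.right.imI ^ 2 + x.right.imJ ^ 2 + x.right.imK ^ 2) := by
  rw [← real_inner_self_eq_norm_sq, inner_eq, real_inner_self_eq_norm_sq,
    real_inner_self_eq_norm_sq, sq ‖x.left‖, sq ‖x.right‖, ← Quaternion.normSq_eq_norm_mul_self,
    ← Quaternion.normSq_eq_norm_mul_self, Quaternion.normSq_def', Quaternion.normSq_def']

end Octonion

open Octonion in
theorem isCompositionAlgebra_octonion : IsCompositionAlgebra Octonion where
  add_mul a b c := by
    apply ext_components <;> simp only [left_add, right_add, left_mul, right_mul] <;> noncomm_ring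
  mul_add a b c := by
    apply ext_components <;>
      simp only [left_add, right_add, left_mul, right_mul, star_add] <;> noncomm_ring
  smul_mul t a b := by
    apply ext_components <;> simp [left_smul, right_smul, left_mul, right_mul, smul_sub]
  mul_smul t a b := by
    apply ext_components <;> simp [left_smul, right_smul, left_mul, right_mul, smul_sub]
  mul_one a := by
    apply ext_components <;> simp [left_mul, right_mul, left_one, right_one]
  star_add a b := by
    apply ext_components <;> simp [left_add, right_add, left_star, right_star, add_comm]
  star_smul t a := by
    apply ext_components <;> simp [left_smul, right_smul, left_star, right_star]
  star_star a := by
    apply ext_components <;> simp [left_star, right_star]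
  star_mul a b := by
    apply ext_components <;> simp [left_star, right_star, left_mul, right_mul, add_comm]
  star_one := by
    apply ext_components <;> simp [left_star, right_star, left_one, right_one]
  norm_one := by
    refine (pow_eq_one_iff_of_nonneg (norm_nonneg _) two_ne_zero).1 ?_
    rw [norm_sq_eq]
    simp [left_one, right_one, Quaternion.re_one, Quaternion.imI_one, Quaternion.imJ_one,
      Quaternion.imK_one,
      Quaternion.re_zero, Quaternion.imI_zero, Quaternion.imJ_zero, Quaternion.imK_zero]
  -- Degen's eight-square identity in real coordinates.
  norm_mul a b := by
    refine (sq_eq_sq₀ (norm_nonneg _) (by positivity)).1 ?_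
    rw [mul_pow, norm_sq_eq, norm_sq_eq, norm_sq_eq]
    simp [left_mul, right_mul]; ring
  norm_star a := by
    refine (sq_eq_sq₀ (norm_nonneg _) (norm_nonneg _)).1 ?_
    rw [norm_sq_eq, norm_sq_eq]
    simp [left_star, right_star]
  mul_star_self a := by
    rw [norm_sq_eq]
    apply ext_components <;> ext <;>
      simp [left_smul, right_smul, left_mul, right_mul, left_star, right_star, left_one,
        right_one, Quaternion.re_one, Quaternion.imI_one, Quaternion.imJ_one,
      Quaternion.imK_one] <;> ring
  inner_mul a b c := by
    simp [inner_eq, Quaternion.inner_def, left_mul, right_mul, left_star, right_star]; ring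
  inner_one_mul_star a b := by
    simp [inner_eq, Quaternion.inner_def, left_mul, right_mul, left_star, right_star, left_one,
      right_one]; ring

namespace Octonion

theorem one_mul (a : Octonion) : 1 * a = a := by
  apply ext_components <;> simp [left_mul, right_mul, left_one, right_one]

/-- A form of left alternativity, as a polynomial identity in real coordinates; the next lemma is
its right-handed counterpart. -/
theorem star_mul_mul_cancel (a b : Octonion) : star a * (a * b) = (‖a‖ ^ 2) • b := by
  rw [norm_sq_eq]
  apply ext_components <;> ext <;>
    simp [left_smul, right_smul, left_mul, right_mul, left_star, right_star] <;> ring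

theorem mul_star_mul_cancel (a b : Octonion) : (b * star a) * a = (‖a‖ ^ 2) • b := by
  rw [norm_sq_eq]
  apply ext_components <;> ext <;>
    simp [left_smul, right_smul, left_mul, right_mul, left_star, right_star] <;> ring

/-- Two octonions generate an associative subalgebra; this is the instance needed for the
projections onto lines in `𝕆³`. -/
theorem mul_star_mul_mul_star {d : ℕ} (hd : d ≤ 2) (v : Fin (d + 1) → Octonion)
    (hv : ∃ k, v k = 1) (i j k : Fin (d + 1)) :
    (v i * star (v k)) * (v k * star (v j)) = (‖v k‖ ^ 2) • (v i * star (v j)) := by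
  have h := isCompositionAlgebra_octonion
  obtain ⟨l, hl⟩ := hv
  by_cases hik : i = k
  · rw [hik, h.mul_star_self, h.smul_mul, one_mul]
  by_cases hjk : j = k
  · rw [hjk, h.mul_star_self, h.mul_smul, h.mul_one]
  by_cases hij : i = j
  · have h1 := h.mul_star_self (v j * star (v k))
    rw [h.star_mul, h.star_star] at h1
    rw [hij, h1, h.mul_star_self, smul_smul, h.norm_mul, h.norm_star, mul_pow, mul_comm]
  -- For `d ≤ 2` three distinct indices exhaust `Fin (d + 1)`, so one of the three octonions is 1
  -- and only two remain.
  have hcases : l = i ∨ l = j ∨ l = k := by omega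
  rcases hcases with rfl | rfl | rfl
  · rw [hl, one_mul, one_mul, star_mul_mul_cancel]
  · rw [hl, h.star_one, h.mul_one, h.mul_one, mul_star_mul_cancel]
  · rw [hl, h.star_one, h.mul_one, one_mul, h.norm_one, one_pow, one_smul]

instance : FiniteDimensional ℝ Octonion :=
  inferInstanceAs (FiniteDimensional ℝ (WithLp 2 (Quaternion ℝ × Quaternion ℝ)))

theorem finrank_eq : Module.finrank ℝ Octonion = 8 := by
  have h : Module.finrank ℝ (WithLp 2 (Quaternion ℝ × Quaternion ℝ)) = 8 := by
    rw [(WithLp.linearEquiv 2 ℝ (Quaternion ℝ × Quaternion ℝ)).finrank_eq, Module.finrank_prod,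
      Quaternion.finrank_eq_four]
  exact h

end Octonion

theorem mul_star_mul_mul_star_of_assoc {F : Type} [NormedRing F] [InnerProductSpace ℝ F]
    [Star F] (h : IsCompositionAlgebra F) (a b c : F) :
    (a * star c) * (c * star b) = (‖c‖ ^ 2) • (a * star b) := by
  have h1 := h.mul_star_self (star c)
  rw [h.star_star, h.norm_star] at h1
  rw [mul_assoc, ← mul_assoc (star c), h1, h.smul_mul, one_mul, h.mul_smul]

/-! ### The bound for each family of spaces -/

theorem proposition4p4 (Ω : TwoPointSpace) (s : ℝ) (hs0 : 0 ≤ s) (hsD : s < (Ω.dim : ℝ)) :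
    ∃ A C : ℝ, 0 < A ∧ 0 < C ∧ ∀ ε : ℝ, 0 < ε → ∀ x y : Ω.Point,
      (0 < s →
        (Ω.uniform (Ω.geoBall ε x) * Ω.uniform (Ω.geoBall ε y))⁻¹ *
            (∫⁻ u in Ω.geoBall ε x, ∫⁻ v in Ω.geoBall ε y,
              ENNReal.ofReal (Ω.geodist u v) ^ (-s) ∂Ω.uniform ∂Ω.uniform)
          ≤ ENNReal.ofReal C * ENNReal.ofReal (Ω.geodist x y) ^ (-s)) ∧
      (s = 0 →
        IntegrableOn (fun p : Ω.Point × Ω.Point => -Real.log (Ω.geodist p.1 p.2))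
          (Ω.geoBall ε x ×ˢ Ω.geoBall ε y) (Ω.uniform.prod Ω.uniform) ∧
        (x ≠ y →
          (Ω.uniform.real (Ω.geoBall ε x) * Ω.uniform.real (Ω.geoBall ε y))⁻¹ *
              (∫ u in Ω.geoBall ε x, ∫ v in Ω.geoBall ε y,
                -Real.log (Ω.geodist u v) ∂Ω.uniform ∂Ω.uniform)
            ≤ A - C * Real.log (Ω.geodist x y))) := by
  rcases Ω with ⟨d, hd⟩ | ⟨d, hd⟩ | ⟨d, hd⟩ | ⟨d, hd⟩ | ⟨d, hd, hd'⟩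
  · refine TwoPointSpace.energy_bound_of_charts (.sphere d hd) (E := EuclideanSpace ℝ (Fin d))
      (by simp [TwoPointSpace.dim]) hd (hasUniformCharts_sphere d) ?_
      (κ := 1 / 2) (by norm_num) (by norm_num) (fun x y => ?_) (fun x y => ?_) s hs0 hsD
    · exact (isCompact_univ (X := Metric.sphere (0 : EuclideanSpace ℝ (Fin (d + 1))) 1)).totallyBounded
    · exact congrArg Real.arccos (real_inner_eq_of_mem_sphere x y)
    · exact (dist_triangle_right _ _ (0 : EuclideanSpace ℝ (Fin (d + 1)))).trans
        (by rw [Metric.mem_sphere.1 x.2, Metric.mem_sphere.1 y.2]; norm_num)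
  · have h := isCompositionAlgebra_real
    exact TwoPointSpace.energy_bound_of_charts (.realProj d hd) (E := Fin d → ℝ)
      (by simp [TwoPointSpace.dim]) hd
      (ProjSpace.hasUniformCharts h hd fun v _ i j k => mul_star_mul_mul_star_of_assoc h _ _ _)
      (ProjSpace.totallyBounded_univ h) (by norm_num) le_rfl (ProjSpace.geodist_eq h)
      (ProjSpace.dist_le_two h) s hs0 hsD
  · have h := isCompositionAlgebra_complex
    exact TwoPointSpace.energy_bound_of_charts (.complexProj d hd) (E := Fin d → ℂ)
      (by simp [TwoPointSpace.dim, Module.finrank_pi_fintype, mul_comm])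
      (by simp only [TwoPointSpace.dim]; omega)
      (ProjSpace.hasUniformCharts h hd fun v _ i j k => mul_star_mul_mul_star_of_assoc h _ _ _)
      (ProjSpace.totallyBounded_univ h) (by norm_num) le_rfl (ProjSpace.geodist_eq h)
      (ProjSpace.dist_le_two h) s hs0 hsD
  · have h := isCompositionAlgebra_quaternion
    exact TwoPointSpace.energy_bound_of_charts (.quaternionProj d hd) (E := Fin d → Quaternion ℝ)
      (by simp [TwoPointSpace.dim, Module.finrank_pi_fintype, Quaternion.finrank_eq_four, mul_comm])
      (by simp only [TwoPointSpace.dim]; omega)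
      (ProjSpace.hasUniformCharts h hd fun v _ i j k => mul_star_mul_mul_star_of_assoc h _ _ _)
      (ProjSpace.totallyBounded_univ h) (by norm_num) le_rfl (ProjSpace.geodist_eq h)
      (ProjSpace.dist_le_two h) s hs0 hsD
  · have h := isCompositionAlgebra_octonion
    exact TwoPointSpace.energy_bound_of_charts (.octonionProj d hd hd') (E := Fin d → Octonion)
      (by simp [TwoPointSpace.dim, Module.finrank_pi_fintype, Octonion.finrank_eq, mul_comm])
      (by simp only [TwoPointSpace.dim]; omega)
      (ProjSpace.hasUniformCharts h hd (Octonion.mul_star_mul_mul_star hd'))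
      (ProjSpace.totallyBounded_univ h) (by norm_num) le_rfl (ProjSpace.geodist_eq h)
      (ProjSpace.dist_le_two h) s hs0 hsD
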